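/- Let $N\ge 1$ be an integer, $p>1$, $M>0$, and set $\beta=1/(p-1)$ and $q^*=N(p-1)/2$. There exist constants $\eta_1,k_1>0$, depending only on $M,p,N$, with the following property. Let $\Omega\subset\mathbb{R}^N$ be any smooth (possibly unbounded) domain, let $u_0\in L^\infty(\Omega)$, and let $u$ be the maximal classical solution of $$u_t=\Delta u+|u|^{p-1}u \ \text{ in } (0,T)\times\Omega,\qquad u=0 \ \text{ on } (0,T)\times\partial\Omega,\qquad u(0,\cdot)=u_0 \ \text{ in } \Omega.$$ Here a classical solution is of class $C^{1,2}$ in $(0,T)\times\Omega$, continuous on $(0,T)\times\overline\Omega$, bounded on $(0,T')\times\Omega$ for every $T'<T$, and $u(t,\cdot)\to u_0$ as $t\to0^+$ in $L^1(\Omega\cap B_R(0))$ for every $R>0$. Assume that the maximal existence time $T$ is finite and that $$\|u(t)\|_{L^\infty(\Omega)}\le M(T-t)^{-\beta},\qquad 0\le t<T.$$ Then for every blow-up point $a$ of $u$, that is, every $a\in\overline\Omega$ with $\limsup_{t\to T,\,x\to a}|u(t,x)|=\infty$, we have $$\int_{\Omega\cap\{|x-a|\le k_1\sqrt{T-t}\}}|u(t,x)|^{q^*}\,dx\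 \ge\ \eta_1\qquad\text{for all } 0\le t<T.$$ -/

import Mathlib

open MeasureTheory Filter Topology Set
open scoped ContDiff ENNReal

namespace SemilinearHeat

/-- A smooth, possibly unbounded domain: a nonempty connected open set which, near each of its
boundary points, is the sublevel set `{φ < 0}` of a smooth function `φ` with nonvanishing
differential at that point. -/
structure IsSmoothDomain {N : ℕ} (Ω : Set (EuclideanSpace ℝ (Fin N))) : Prop where
  isOpen : IsOpen Ω
  isConnected : IsConnected Ω
  smooth_boundary : ∀ a ∈ frontier Ω, ∃ U ∈ 𝓝 a, ∃ φ : EuclideanSpace ℝ (Fin N) → ℝ,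
    ContDiff ℝ ∞ φ ∧ fderiv ℝ φ a ≠ 0 ∧ Ω ∩ U = {x | φ x < 0} ∩ U

/-- `u` is a classical solution on `[0, T)` of the Dirichlet problem
`u_t = Δu + |u|^(p-1) u` in `Ω`, `u = 0` on `∂Ω`, `u(0) = u₀`, where `u₀ ∈ L^∞(Ω)`.

The solution is `C^{1,2}` in `(0, T) × Ω`, continuous on `(0, T) × closure Ω` and bounded on
`(0, T') × Ω` for each `T' < T`. As `u₀` is merely bounded, it is attained in the sense of
`L¹` on bounded subsets of `Ω`. -/
structure IsClassicalSolution {N : ℕ} (p : ℝ) (Ω : Set (EuclideanSpace ℝ (Fin N)))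
    (u₀ : EuclideanSpace ℝ (Fin N) → ℝ) (T : ℝ)
    (u : ℝ → EuclideanSpace ℝ (Fin N) → ℝ) : Prop where
  contDiffOn_space : ∀ t ∈ Ioo 0 T, ContDiffOn ℝ 2 (u t) Ω
  differentiableAt_time : ∀ t ∈ Ioo 0 T, ∀ x ∈ Ω, DifferentiableAt ℝ (fun s => u s x) t
  continuousOn_deriv_time :
    ContinuousOn (fun z : ℝ × EuclideanSpace ℝ (Fin N) => deriv (fun s => u s z.2) z.1)
      (Ioo 0 T ×ˢ Ω)
  continuousOn_fderiv_space :
    ContinuousOn (fun z : ℝ × EuclideanSpace ℝ (Fin N) => fderiv ℝ (u z.1) z.2)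
      (Ioo 0 T ×ˢ Ω)
  continuousOn_iteratedFDeriv_space :
    ContinuousOn (fun z : ℝ × EuclideanSpace ℝ (Fin N) => iteratedFDeriv ℝ 2 (u z.1) z.2)
      (Ioo 0 T ×ˢ Ω)
  continuousOn_closure :
    ContinuousOn (fun z : ℝ × EuclideanSpace ℝ (Fin N) => u z.1 z.2) (Ioo 0 T ×ˢ closure Ω)
  locally_bounded : ∀ T' < T, ∃ C : ℝ, ∀ t ∈ Ioo 0 T', ∀ x ∈ Ω, |u t x| ≤ C
  equation : ∀ t ∈ Ioo 0 T, ∀ x ∈ Ω,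
    deriv (fun s => u s x) t = Laplacian.laplacian (u t) x + |u t x| ^ (p - 1) * u t x
  boundary : ∀ t ∈ Ioo 0 T, ∀ x ∈ frontier Ω, u t x = 0
  initial : u 0 =ᵐ[volume.restrict Ω] u₀
  initial_limit : ∀ R > 0,
    Tendsto (fun t => ∫⁻ x in Ω ∩ Metric.ball 0 R, ‖u t x - u₀ x‖ₑ) (𝓝[>] 0) (𝓝 0)

/-- `u` is a blow-up solution with blow-up time `T`: it is the maximal classical solution for the
initial data `u₀`, and its maximal existence time is the finite number `T > 0`. -/
structure IsBlowUpSolution {N : ℕ} (p : ℝ) (Ω : Set (EuclideanSpace ℝ (Fin N)))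
    (u₀ : EuclideanSpace ℝ (Fin N) → ℝ) (T : ℝ)
    (u : ℝ → EuclideanSpace ℝ (Fin N) → ℝ) : Prop where
  time_pos : 0 < T
  isClassicalSolution : IsClassicalSolution p Ω u₀ T u
  maximal : ∀ T' > T, ¬ ∃ v, IsClassicalSolution p Ω u₀ T' v

/-- The type I estimate `‖u(t)‖_∞ ≤ M (T - t)^(-β)` for `0 ≤ t < T`, where `β = 1 / (p - 1)`. -/
def TypeIEstimate {N : ℕ} (p : ℝ) (Ω : Set (EuclideanSpace ℝ (Fin N))) (T M : ℝ)
    (u : ℝ → EuclideanSpace ℝ (Fin N) → ℝ) : Prop :=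
  ∀ t ∈ Ico 0 T, eLpNorm (u t) ⊤ (volume.restrict Ω) ≤
    ENNReal.ofReal (M * (T - t) ^ (-(1 / (p - 1))))

/-- `a ∈ closure Ω` is a blow-up point of `u` at time `T`:
`limsup |u(t, x)| = ∞` as `t → T`, `x → a` with `t < T`, `x ∈ Ω`. -/
def IsBlowUpPoint {N : ℕ} (Ω : Set (EuclideanSpace ℝ (Fin N))) (T : ℝ)
    (u : ℝ → EuclideanSpace ℝ (Fin N) → ℝ) (a : EuclideanSpace ℝ (Fin N)) : Prop :=
  a ∈ closure Ω ∧
    limsup (fun z : ℝ × EuclideanSpace ℝ (Fin N) => ‖u z.1 z.2‖ₑ) (𝓝[<] T ×ˢ 𝓝[Ω] a) = ⊤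

end SemilinearHeat

namespace SemilinearHeat

/-- At an interior local maximum the second derivative is nonpositive. -/
theorem second_deriv_nonpos_of_isLocalMax {g g' : ℝ → ℝ} {d : ℝ} (hmax : IsLocalMax g 0)
    (hg : ∀ᶠ s in 𝓝 0, HasDerivAt g (g' s) s) (hd : HasDerivAt g' d 0) : d ≤ 0 := by
  by_contra! hpos
  have hderiv : deriv g =ᶠ[𝓝 0] g' := hg.mono fun s hs => hs.deriv
  have h2 : deriv (deriv g) 0 = d := by rw [hderiv.deriv_eq, hd.deriv]
  have hmin : IsLocalMin g 0 := isLocalMin_of_deriv_deriv_pos (by rw [h2]; exact hpos)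
    hmax.deriv_eq_zero hg.self_of_nhds.continuousAt
  have hconst : g =ᶠ[𝓝 0] fun _ => g 0 := by
    filter_upwards [hmax, hmin] with s h1 h2 using le_antisymm h1 h2
  have h3 : deriv (deriv g) 0 = 0 := by
    rw [hconst.deriv.deriv_eq]; simp
  linarith

/-- `f` has second derivative `d` at `x` along the line in the direction `e`. -/
def HasSecondDerivAlong {E : Type*} [AddCommGroup E] [Module ℝ E] (f : E → ℝ) (x e : E)
    (d : ℝ) : Prop :=
  ∃ g' : ℝ → ℝ, (∀ᶠ s in 𝓝 (0 : ℝ), HasDerivAt (fun s : ℝ => f (x + s • e)) (g' s) s) ∧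
    HasDerivAt g' d 0

/-- The second derivatives of `f` at `x` along the coordinate axes exist and add up to `L`. -/
def HasLaplacianAt {N : ℕ} (f : EuclideanSpace ℝ (Fin N) → ℝ) (x : EuclideanSpace ℝ (Fin N))
    (L : ℝ) : Prop :=
  ∃ d : Fin N → ℝ,
    (∀ i, HasSecondDerivAlong f x (EuclideanSpace.basisFun (Fin N) ℝ i) (d i)) ∧ L = ∑ i, d i

namespace HasLaplacianAt

variable {N : ℕ} {f g : EuclideanSpace ℝ (Fin N) → ℝ} {x : EuclideanSpace ℝ (Fin N)} {L L' : ℝ}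

theorem add (hf : HasLaplacianAt f x L) (hg : HasLaplacianAt g x L') :
    HasLaplacianAt (fun y => f y + g y) x (L + L') := by
  obtain ⟨d, hd, rfl⟩ := hf
  obtain ⟨d', hd', rfl⟩ := hg
  refine ⟨fun i => d i + d' i, fun i => ?_, Finset.sum_add_distrib.symm⟩
  obtain ⟨k, hk, hk2⟩ := hd i
  obtain ⟨k', hk', hk2'⟩ := hd' i
  refine ⟨fun s => k s + k' s, ?_, hk2.add hk2'⟩
  filter_upwards [hk, hk'] with s h1 h2 using h1.add h2

theorem const_mul (hf : HasLaplacianAt f x L) (c : ℝ) :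
    HasLaplacianAt (fun y => c * f y) x (c * L) := by
  obtain ⟨d, hd, rfl⟩ := hf
  refine ⟨fun i => c * d i, fun i => ?_, Finset.mul_sum _ _ _⟩
  obtain ⟨k, hk, hk2⟩ := hd i
  refine ⟨fun s => c * k s, ?_, hk2.const_mul c⟩
  filter_upwards [hk] with s h1 using h1.const_mul c

theorem neg (hf : HasLaplacianAt f x L) : HasLaplacianAt (fun y => -f y) x (-L) := by
  simpa using hf.const_mul (-1)

theorem sub (hf : HasLaplacianAt f x L) (hg : HasLaplacianAt g x L') :
    HasLaplacianAt (fun y => f y - g y) x (L - L') := by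
  simpa [sub_eq_add_neg] using hf.add hg.neg

theorem const (c : ℝ) (x : EuclideanSpace ℝ (Fin N)) : HasLaplacianAt (fun _ => c) x 0 :=
  ⟨fun _ => 0, fun _ => ⟨fun _ => 0, Eventually.of_forall fun s => hasDerivAt_const s c,
    hasDerivAt_const _ _⟩, by simp⟩

theorem nonpos_of_isLocalMax (hf : HasLaplacianAt f x L) (hmax : IsLocalMax f x) : L ≤ 0 := by
  obtain ⟨d, hd, rfl⟩ := hf
  refine Finset.sum_nonpos fun i _ => ?_
  obtain ⟨k, hk, hk2⟩ := hd i
  refine second_deriv_nonpos_of_isLocalMax (g := fun s : ℝ =>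
    f (x + s • EuclideanSpace.basisFun (Fin N) ℝ i)) ?_ hk hk2
  have hc : Tendsto (fun s : ℝ => x + s • EuclideanSpace.basisFun (Fin N) ℝ i) (𝓝 0) (𝓝 x) := by
    have : Continuous (fun s : ℝ => x + s • EuclideanSpace.basisFun (Fin N) ℝ i) := by fun_prop
    simpa using this.tendsto 0
  filter_upwards [hc.eventually hmax] with s hs
  simpa using hs

theorem of_contDiffAt (hf : ContDiffAt ℝ 2 f x) : HasLaplacianAt f x (Laplacian.laplacian f x) := by
  rw [InnerProductSpace.laplacian_eq_iteratedFDeriv_orthonormalBasis f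
    (EuclideanSpace.basisFun (Fin N) ℝ)]
  refine ⟨_, fun i => ?_, rfl⟩
  set e := EuclideanSpace.basisFun (Fin N) ℝ i
  have hline : ∀ s : ℝ, HasDerivAt (fun s : ℝ => x + s • e) e s := fun s => by
    simpa using ((hasDerivAt_id s).smul_const e).const_add x
  have hc : Tendsto (fun s : ℝ => x + s • e) (𝓝 0) (𝓝 x) := by
    simpa using (hline 0).continuousAt.tendsto
  refine ⟨fun s => fderiv ℝ f (x + s • e) e, ?_, ?_⟩
  · have h1 : ∀ᶠ y in 𝓝 x, DifferentiableAt ℝ f y :=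
      (hf.eventually (by simp)).mono fun y hy => hy.differentiableAt (by simp)
    filter_upwards [hc.eventually h1] with s hs
    exact hs.hasFDerivAt.comp_hasDerivAt s (hline s)
  · have h2 : DifferentiableAt ℝ (fderiv ℝ f) x :=
      (hf.fderiv_right (m := 1) (by norm_num)).differentiableAt (by simp)
    have h3 : HasFDerivAt (fderiv ℝ f) (fderiv ℝ (fderiv ℝ f) x) (x + (0 : ℝ) • e) := by
      simpa using h2.hasFDerivAt
    have h4 := (ContinuousLinearMap.apply ℝ ℝ e).hasFDerivAt.comp_hasDerivAt (0 : ℝ)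
      (h3.comp_hasDerivAt (0 : ℝ) (hline 0))
    rw [iteratedFDeriv_two_apply]
    exact h4

/-- The Laplacian under an affine change of variables. -/
theorem comp_affine {a : EuclideanSpace ℝ (Fin N)} {r : ℝ}
    (hf : HasLaplacianAt f (a + r • x) L) :
    HasLaplacianAt (fun y => f (a + r • y)) x (r ^ 2 * L) := by
  obtain ⟨d, hd, rfl⟩ := hf
  refine ⟨fun i => r ^ 2 * d i, fun i => ?_, Finset.mul_sum _ _ _⟩
  obtain ⟨k, hk, hk2⟩ := hd i
  have hlin : ∀ s : ℝ, HasDerivAt (fun s : ℝ => r * s) r s := fun s => by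
    simpa using (hasDerivAt_id s).const_mul r
  refine ⟨fun s => r * k (r * s), ?_, ?_⟩
  · have hc : Tendsto (fun s : ℝ => r * s) (𝓝 0) (𝓝 0) := by
      simpa using (hlin 0).continuousAt.tendsto
    filter_upwards [hc.eventually hk] with s hs
    have heq : (fun σ : ℝ => f (a + r • (x + σ • EuclideanSpace.basisFun (Fin N) ℝ i))) =
        (fun σ : ℝ => f (a + r • x + σ • EuclideanSpace.basisFun (Fin N) ℝ i)) ∘
          fun σ => r * σ := by
      funext σ
      simp only [Function.comp_apply, smul_add, smul_smul, add_assoc]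
    rw [heq, mul_comm]
    exact hs.comp s (hlin s)
  · have h := (HasDerivAt.comp (0 : ℝ) (by simpa using hk2) (hlin 0)).const_mul r
    have heq : r ^ 2 * d i = r * (d i * r) := by ring
    change HasDerivAt _ (r ^ 2 * d i) _
    rw [heq]
    exact h

end HasLaplacianAt

/-- First contact argument: a function which is negative on the parabolic boundary of a cylinder,
and which is a strict subsolution of the heat equation at its zeros, is negative. -/
theorem neg_of_strict_subsolution {N : ℕ} {K U : Set (EuclideanSpace ℝ (Fin N))}
    {w : ℝ → EuclideanSpace ℝ (Fin N) → ℝ} {t₀ t₁ : ℝ} (hK : IsCompact K) (hU : IsOpen U)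
    (hUK : U ⊆ K)
    (hw : ContinuousOn (fun z : ℝ × EuclideanSpace ℝ (Fin N) => w z.1 z.2) (Icc t₀ t₁ ×ˢ K))
    (hinit : ∀ x ∈ K, w t₀ x < 0)
    (hlat : ∀ t ∈ Icc t₀ t₁, ∀ x ∈ K, x ∉ U → w t x < 0)
    (hint : ∀ t ∈ Ioc t₀ t₁, ∀ x ∈ U, w t x = 0 → ∃ wt L, HasDerivAt (fun s => w s x) wt t ∧
      HasLaplacianAt (w t) x L ∧ wt < L) :
    ∀ t ∈ Icc t₀ t₁, ∀ x ∈ K, w t x < 0 := by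
  by_contra! hne
  obtain ⟨s₀, hs₀, y₀, hy₀, hsy⟩ := hne
  have hcyl : IsCompact (Icc t₀ t₁ ×ˢ K) := isCompact_Icc.prod hK
  obtain ⟨C, hC, hCeq⟩ := continuousOn_iff_isClosed.1 hw (Ici 0) isClosed_Ici
  set S := (fun z : ℝ × EuclideanSpace ℝ (Fin N) => w z.1 z.2) ⁻¹' Ici 0 ∩ (Icc t₀ t₁ ×ˢ K)
    with hS
  have hScomp : IsCompact S := by
    rw [hCeq]; exact hcyl.inter_left hC
  obtain ⟨⟨t, x⟩, htx, hmin⟩ := hScomp.exists_isMinOn ⟨(s₀, y₀), hsy, hs₀, hy₀⟩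
    continuous_fst.continuousOn
  obtain ⟨hpos, ht, hx⟩ := htx
  simp only [mem_preimage, mem_Ici] at hpos ht hx
  have hbefore : ∀ s ∈ Icc t₀ t₁, s < t → ∀ y ∈ K, w s y < 0 := by
    intro s hs hst y hy
    by_contra! h
    have := hmin (show (s, y) ∈ S from ⟨h, hs, hy⟩)
    change t ≤ s at this
    linarith
  have ht₀ : t₀ < t := by
    rcases ht.1.eq_or_lt with h | h
    · rw [← h] at hpos; linarith [hinit x hx]
    · exact h
  have hxU : x ∈ U := by
    by_contra h
    linarith [hlat t ht x hx h]
  have hnow : ∀ y ∈ K, w t y ≤ 0 := by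
    intro y hy
    have hcont : ContinuousOn (fun s => w s y) (Icc t₀ t₁) :=
      hw.comp (by fun_prop : ContinuousOn (fun s : ℝ => (s, y)) (Icc t₀ t₁))
        fun s hs => ⟨hs, hy⟩
    have hcl : t ∈ closure (Ioo t₀ t) := by
      rw [closure_Ioo ht₀.ne]; exact ⟨ht₀.le, le_rfl⟩
    have hsub : Ioo t₀ t ⊆ Icc t₀ t₁ := fun s hs => ⟨hs.1.le, hs.2.le.trans ht.2⟩
    have hne : (𝓝[Ioo t₀ t] t).NeBot := mem_closure_iff_nhdsWithin_neBot.1 hcl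
    refine le_of_tendsto ((hcont t ht).mono hsub) ?_
    filter_upwards [self_mem_nhdsWithin] with s hs
    exact (hbefore s (hsub hs) hs.2 y hy).le
  have hzero : w t x = 0 := le_antisymm (hnow x hx) hpos
  obtain ⟨wt, L, hwt, hL, hlt⟩ := hint t ⟨ht₀, ht.2⟩ x hxU hzero
  have hL0 : L ≤ 0 := hL.nonpos_of_isLocalMax <| by
    filter_upwards [hU.mem_nhds hxU] with y hy
    rw [hzero]; exact hnow y (hUK hy)
  have hwt0 : 0 ≤ wt := by
    have hslope := hwt.tendsto_slope.mono_left (nhdsLT_le_nhdsNE t)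
    refine ge_of_tendsto hslope ?_
    filter_upwards [Ioo_mem_nhdsLT ht₀] with s hs
    have h1 := hbefore s ⟨hs.1.le, hs.2.le.trans ht.2⟩ hs.2 x hx
    rw [slope_def_field]
    simp only [hzero]
    have : s - t < 0 := by linarith [hs.2]
    rw [sub_zero]
    exact (div_pos_of_neg_of_neg h1 this).le
  linarith

/-- A classical solution on `[0, 1)` of the Dirichlet problem, continuous up to the initial time
and satisfying the type I bound `|v| ≤ M (1 - t)^(-β)` pointwise. -/
structure IsTypeISolution {N : ℕ} (p M : ℝ) (Ω : Set (EuclideanSpace ℝ (Fin N)))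
    (v : ℝ → EuclideanSpace ℝ (Fin N) → ℝ) : Prop where
  isOpen : IsOpen Ω
  continuousOn : ContinuousOn (fun z : ℝ × EuclideanSpace ℝ (Fin N) => v z.1 z.2)
    (Ico 0 1 ×ˢ closure Ω)
  boundary : ∀ t ∈ Ico (0 : ℝ) 1, ∀ x ∈ frontier Ω, v t x = 0
  bound : ∀ t ∈ Ico (0 : ℝ) 1, ∀ x ∈ closure Ω, |v t x| ≤ M * (1 - t) ^ (-(1 / (p - 1)))
  equation : ∀ t ∈ Ioo (0 : ℝ) 1, ∀ x ∈ Ω, ∃ vt L, HasDerivAt (fun s => v s x) vt t ∧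
    HasLaplacianAt (v t) x L ∧ vt = L + |v t x| ^ (p - 1) * v t x

namespace IsTypeISolution

variable {N : ℕ} {p M : ℝ} {Ω : Set (EuclideanSpace ℝ (Fin N))}
  {v z : ℝ → EuclideanSpace ℝ (Fin N) → ℝ} {t₀ t₁ R : ℝ} {b : EuclideanSpace ℝ (Fin N)}

theorem neg (hv : IsTypeISolution p M Ω v) : IsTypeISolution p M Ω (fun t x => -v t x) where
  isOpen := hv.isOpen
  continuousOn := hv.continuousOn.neg
  boundary t ht x hx := by simp [hv.boundary t ht x hx]
  bound t ht x hx := by simpa using hv.bound t ht x hx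
  equation t ht x hx := by
    obtain ⟨vt, L, h1, h2, h3⟩ := hv.equation t ht x hx
    exact ⟨-vt, -L, h1.neg, h2.neg, by rw [h3, abs_neg]; ring⟩

theorem lt_of_strict_supersolution (hv : IsTypeISolution p M Ω v) (ht₀ : 0 ≤ t₀) (ht₁ : t₁ < 1)
    (hz : ContinuousOn (fun q : ℝ × EuclideanSpace ℝ (Fin N) => z q.1 q.2)
      (Icc t₀ t₁ ×ˢ Metric.closedBall b R))
    (hzpos : ∀ t ∈ Icc t₀ t₁, ∀ x ∈ Metric.closedBall b R, 0 < z t x)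
    (hinit : ∀ x ∈ Metric.closedBall b R, x ∈ closure Ω → v t₀ x < z t₀ x)
    (hlat : ∀ t ∈ Icc t₀ t₁, ∀ x ∈ Metric.sphere b R, M * (1 - t) ^ (-(1 / (p - 1))) < z t x)
    (hint : ∀ t ∈ Ioc t₀ t₁, ∀ x ∈ Metric.ball b R, z t x ≤ M * (1 - t) ^ (-(1 / (p - 1))) →
      ∃ zt L, HasDerivAt (fun s => z s x) zt t ∧ HasLaplacianAt (z t) x L ∧
        z t x ^ (p - 1) * z t x < zt - L) :
    ∀ t ∈ Icc t₀ t₁, ∀ x ∈ Metric.closedBall b R, x ∈ closure Ω → v t x < z t x := by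
  have hmem : ∀ {t}, t ∈ Icc t₀ t₁ → t ∈ Ico (0 : ℝ) 1 := fun ht =>
    ⟨ht₀.trans ht.1, ht.2.trans_lt ht₁⟩
  have key := neg_of_strict_subsolution (K := Metric.closedBall b R ∩ closure Ω)
    (U := Metric.ball b R ∩ Ω) (w := fun t x => v t x - z t x) (t₀ := t₀) (t₁ := t₁)
    ((isCompact_closedBall b R).inter_right isClosed_closure) (Metric.isOpen_ball.inter hv.isOpen)
    (inter_subset_inter Metric.ball_subset_closedBall subset_closure)
    ((hv.continuousOn.mono (prod_mono (fun t ht => hmem ht) inter_subset_right)).sub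
      (hz.mono (prod_mono subset_rfl inter_subset_left)))
    (fun x hx => sub_neg.2 (hinit x hx.1 hx.2)) ?_ ?_
  · intro t ht x hx hxΩ
    exact sub_neg.1 (key t ht x ⟨hx, hxΩ⟩)
  · rintro t ht x ⟨hxb, hxΩ⟩ hxU
    by_cases hx : x ∈ Ω
    · have hs : x ∈ Metric.sphere b R := by
        have : ¬ dist x b < R := fun h => hxU ⟨h, hx⟩
        exact le_antisymm hxb (not_lt.1 this)
      have := (le_abs_self _).trans (hv.bound t (hmem ht) x hxΩ)
      linarith [hlat t ht x hs]
    · have hf : x ∈ frontier Ω := by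
        rw [hv.isOpen.frontier_eq]; exact ⟨hxΩ, hx⟩
      rw [hv.boundary t (hmem ht) x hf]
      linarith [hzpos t ht x hxb]
  · rintro t ht x ⟨hxb, hxΩ⟩ hzero
    have htI : t ∈ Icc t₀ t₁ := ⟨ht.1.le, ht.2⟩
    have hvz : v t x = z t x := sub_eq_zero.1 hzero
    have hzx := hzpos t htI x (Metric.ball_subset_closedBall hxb)
    have hb := (le_abs_self _).trans (hv.bound t (hmem htI) x (subset_closure hxΩ))
    obtain ⟨zt, L, h1, h2, h3⟩ := hint t ht x hxb (hvz ▸ hb)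
    obtain ⟨vt, L', h1', h2', h3'⟩ := hv.equation t ⟨ht₀.trans_lt ht.1, ht.2.trans_lt ht₁⟩ x hxΩ
    refine ⟨vt - zt, L' - L, h1'.sub h1, h2'.sub h2, ?_⟩
    rw [hvz, abs_of_pos hzx] at h3'
    linarith

theorem abs_lt_of_strict_supersolution (hv : IsTypeISolution p M Ω v) (ht₀ : 0 ≤ t₀) (ht₁ : t₁ < 1)
    (hz : ContinuousOn (fun q : ℝ × EuclideanSpace ℝ (Fin N) => z q.1 q.2)
      (Icc t₀ t₁ ×ˢ Metric.closedBall b R))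
    (hzpos : ∀ t ∈ Icc t₀ t₁, ∀ x ∈ Metric.closedBall b R, 0 < z t x)
    (hinit : ∀ x ∈ Metric.closedBall b R, x ∈ closure Ω → |v t₀ x| < z t₀ x)
    (hlat : ∀ t ∈ Icc t₀ t₁, ∀ x ∈ Metric.sphere b R, M * (1 - t) ^ (-(1 / (p - 1))) < z t x)
    (hint : ∀ t ∈ Ioc t₀ t₁, ∀ x ∈ Metric.ball b R, z t x ≤ M * (1 - t) ^ (-(1 / (p - 1))) →
      ∃ zt L, HasDerivAt (fun s => z s x) zt t ∧ HasLaplacianAt (z t) x L ∧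
        z t x ^ (p - 1) * z t x < zt - L) :
    ∀ t ∈ Icc t₀ t₁, ∀ x ∈ Metric.closedBall b R, x ∈ closure Ω → |v t x| < z t x := by
  intro t ht x hx hxΩ
  refine abs_lt.2 ⟨neg_lt.1 ?_, ?_⟩
  · exact hv.neg.lt_of_strict_supersolution ht₀ ht₁ hz hzpos
      (fun x hx hxΩ => (neg_le_abs _).trans_lt (hinit x hx hxΩ)) hlat hint t ht x hx hxΩ
  · exact hv.lt_of_strict_supersolution ht₀ ht₁ hz hzpos
      (fun x hx hxΩ => (le_abs_self _).trans_lt (hinit x hx hxΩ)) hlat hint t ht x hx hxΩ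

end IsTypeISolution

section HeatKernel

variable {N : ℕ}

/-- The heat kernel, up to the normalization constant `(4π)^(-N/2)`. -/
noncomputable def heatKernel (t : ℝ) (x : EuclideanSpace ℝ (Fin N)) : ℝ :=
  t ^ (-((N : ℝ) / 2)) * Real.exp (-(‖x‖ ^ 2 / (4 * t)))

theorem heatKernel_nonneg {t : ℝ} (ht : 0 < t) (x : EuclideanSpace ℝ (Fin N)) :
    0 ≤ heatKernel t x := by
  unfold heatKernel; positivity

theorem continuous_heatKernel (t : ℝ) :
    Continuous (heatKernel t : EuclideanSpace ℝ (Fin N) → ℝ) := by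
  unfold heatKernel; fun_prop

theorem heatKernel_le {s t : ℝ} (hs : 0 < s) (hst : s ≤ t) (x : EuclideanSpace ℝ (Fin N)) :
    heatKernel t x ≤ s ^ (-((N : ℝ) / 2)) := by
  have ht : 0 < t := hs.trans_le hst
  have h1 : t ^ (-((N : ℝ) / 2)) ≤ s ^ (-((N : ℝ) / 2)) :=
    Real.rpow_le_rpow_of_nonpos hs hst (by simp; positivity)
  have h2 : Real.exp (-(‖x‖ ^ 2 / (4 * t))) ≤ 1 :=
    Real.exp_le_one_iff.2 (by simp; positivity)
  unfold heatKernel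
  calc _ ≤ s ^ (-((N : ℝ) / 2)) * 1 := by gcongr
    _ = _ := mul_one _

theorem heatKernel_mul_norm_sq_le {s t : ℝ} (hs : 0 < s) (hst : s ≤ t)
    (x : EuclideanSpace ℝ (Fin N)) :
    heatKernel t x * (‖x‖ ^ 2 / (4 * t)) ≤ s ^ (-((N : ℝ) / 2)) := by
  have ht : 0 < t := hs.trans_le hst
  have h1 : t ^ (-((N : ℝ) / 2)) ≤ s ^ (-((N : ℝ) / 2)) :=
    Real.rpow_le_rpow_of_nonpos hs hst (by simp; positivity)
  set a := ‖x‖ ^ 2 / (4 * t) with ha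
  have ha0 : 0 ≤ a := by positivity
  have h2 : Real.exp (-a) * a ≤ 1 := by
    rw [Real.exp_neg, inv_mul_le_one₀ (Real.exp_pos a)]
    linarith [Real.add_one_le_exp a]
  unfold heatKernel
  rw [← ha, mul_assoc]
  calc _ ≤ s ^ (-((N : ℝ) / 2)) * 1 := by gcongr
    _ = _ := mul_one _

theorem hasDerivAt_heatKernel_time {t : ℝ} (ht : 0 < t) (x : EuclideanSpace ℝ (Fin N)) :
    HasDerivAt (fun s => heatKernel s x)
      (heatKernel t x * (‖x‖ ^ 2 / (4 * t ^ 2) - N / (2 * t))) t := by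
  have h1 := (hasDerivAt_id t).rpow_const (p := -((N : ℝ) / 2)) (Or.inl ht.ne')
  have h2 : HasDerivAt (fun s : ℝ => -(‖x‖ ^ 2 / (4 * s))) (‖x‖ ^ 2 / (4 * t ^ 2)) t := by
    have := ((hasDerivAt_inv ht.ne').const_mul (-(‖x‖ ^ 2 / 4)))
    have heq : (fun s : ℝ => -(‖x‖ ^ 2 / (4 * s))) = fun s => -(‖x‖ ^ 2 / 4) * s⁻¹ := by
      funext s; rw [neg_mul, ← div_eq_mul_inv, div_div]
    rw [heq]
    exact this.congr_deriv (by field_simp)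
  have h3 := h1.mul h2.exp
  unfold heatKernel
  refine h3.congr_deriv ?_
  simp only [id]
  rw [Real.rpow_sub_one ht.ne']
  field_simp
  ring

theorem hasDerivAt_heatKernel_line (t : ℝ) (x : EuclideanSpace ℝ (Fin N)) (i : Fin N) (s : ℝ) :
    HasDerivAt (fun s : ℝ => heatKernel t (x + s • EuclideanSpace.basisFun (Fin N) ℝ i))
      (heatKernel t (x + s • EuclideanSpace.basisFun (Fin N) ℝ i) * (-(x i + s) / (2 * t))) s := by
  have hline : HasDerivAt (fun s : ℝ => x + s • EuclideanSpace.basisFun (Fin N) ℝ i)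
      (EuclideanSpace.basisFun (Fin N) ℝ i) s := by
    simpa using ((hasDerivAt_id s).smul_const (EuclideanSpace.basisFun (Fin N) ℝ i)).const_add x
  have h1 := ((hline.norm_sq.div_const (4 * t)).neg.exp).const_mul (t ^ (-((N : ℝ) / 2)))
  unfold heatKernel
  refine h1.congr_deriv ?_
  have : inner ℝ (x + s • EuclideanSpace.basisFun (Fin N) ℝ i)
      (EuclideanSpace.basisFun (Fin N) ℝ i) = x i + s := by
    simp [inner_add_left, EuclideanSpace.inner_single_right, inner_smul_left]
  rw [this]
  simp only [Pi.neg_apply]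
  ring

theorem hasDerivAt_heatKernel_line_deriv (t : ℝ) (x : EuclideanSpace ℝ (Fin N)) (i : Fin N)
    (s : ℝ) :
    HasDerivAt (fun s : ℝ => heatKernel t (x + s • EuclideanSpace.basisFun (Fin N) ℝ i) *
        (-(x i + s) / (2 * t)))
      (heatKernel t (x + s • EuclideanSpace.basisFun (Fin N) ℝ i) *
        ((x i + s) ^ 2 / (4 * t ^ 2) - 1 / (2 * t))) s := by
  have h1 : HasDerivAt (fun s : ℝ => -(x i + s) / (2 * t)) (-1 / (2 * t)) s :=
    (((hasDerivAt_id s).const_add (x i)).neg).div_const (2 * t)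
  refine ((hasDerivAt_heatKernel_line t x i s).mul h1).congr_deriv ?_
  ring

theorem abs_heatKernel_time_deriv_le {s t : ℝ} (hs : 0 < s) (hst : s ≤ t)
    (x : EuclideanSpace ℝ (Fin N)) :
    |heatKernel t x * (‖x‖ ^ 2 / (4 * t ^ 2) - N / (2 * t))| ≤
      s ^ (-((N : ℝ) / 2)) * ((1 + N) / s) := by
  have ht : 0 < t := hs.trans_le hst
  have h0 := heatKernel_nonneg ht x
  have h1 := heatKernel_le hs hst x
  have h2 := heatKernel_mul_norm_sq_le hs hst x
  set A := s ^ (-((N : ℝ) / 2))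
  have hA : 0 ≤ A := h0.trans h1
  have e1 : heatKernel t x * (‖x‖ ^ 2 / (4 * t ^ 2) - N / (2 * t)) =
      heatKernel t x * (‖x‖ ^ 2 / (4 * t)) * (1 / t) - heatKernel t x * (N * (1 / (2 * t))) := by
    field_simp
  have h3 : 1 / t ≤ 1 / s := by gcongr
  have h4 : 1 / (2 * t) ≤ 1 / s := by gcongr; linarith
  have b1 : heatKernel t x * (‖x‖ ^ 2 / (4 * t)) * (1 / t) ≤ A * (1 / s) := by gcongr
  have b2 : heatKernel t x * (N * (1 / (2 * t))) ≤ A * (N * (1 / s)) := by gcongr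
  have b3 : 0 ≤ heatKernel t x * (‖x‖ ^ 2 / (4 * t)) * (1 / t) := by positivity
  have b4 : 0 ≤ heatKernel t x * (N * (1 / (2 * t))) := by positivity
  have e2 : A * ((1 + N) / s) = A * (1 / s) + A * (N * (1 / s)) := by ring
  rw [e1, e2, abs_le]
  constructor <;> linarith

theorem abs_heatKernel_line_deriv_le {t : ℝ} (ht : 0 < t) (x : EuclideanSpace ℝ (Fin N))
    (i : Fin N) :
    |heatKernel t x * (-(x i) / (2 * t))| ≤ t ^ (-((N : ℝ) / 2)) * (1 / (2 * t) + 2) := by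
  have h0 := heatKernel_nonneg ht x
  have h1 := heatKernel_le ht le_rfl x
  have h2 := heatKernel_mul_norm_sq_le ht le_rfl x
  have hi : |x i| ≤ 1 + ‖x‖ ^ 2 := by
    have h := PiLp.norm_apply_le x i
    rw [Real.norm_eq_abs] at h
    nlinarith [sq_nonneg (‖x‖ - 1), norm_nonneg x]
  rw [abs_mul, abs_of_nonneg h0, abs_div, abs_neg, abs_of_pos (by positivity : 0 < 2 * t)]
  calc heatKernel t x * (|x i| / (2 * t)) ≤ heatKernel t x * ((1 + ‖x‖ ^ 2) / (2 * t)) := by gcongr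
    _ = heatKernel t x * (1 / (2 * t)) + 2 * (heatKernel t x * (‖x‖ ^ 2 / (4 * t))) := by
        field_simp; ring
    _ ≤ t ^ (-((N : ℝ) / 2)) * (1 / (2 * t)) + 2 * t ^ (-((N : ℝ) / 2)) := by gcongr
    _ = _ := by ring

theorem abs_heatKernel_line_deriv_two_le {t : ℝ} (ht : 0 < t) (x : EuclideanSpace ℝ (Fin N))
    (i : Fin N) :
    |heatKernel t x * ((x i) ^ 2 / (4 * t ^ 2) - 1 / (2 * t))| ≤
      t ^ (-((N : ℝ) / 2)) * (2 / t) := by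
  have h0 := heatKernel_nonneg ht x
  have h1 := heatKernel_le ht le_rfl x
  have h2 := heatKernel_mul_norm_sq_le ht le_rfl x
  set A := t ^ (-((N : ℝ) / 2))
  have hA : 0 ≤ A := h0.trans h1
  have hi : x i ^ 2 ≤ ‖x‖ ^ 2 := by
    have h := PiLp.norm_apply_le x i
    rw [Real.norm_eq_abs] at h
    rw [← sq_abs]; gcongr
  have e1 : heatKernel t x * ((x i) ^ 2 / (4 * t ^ 2) - 1 / (2 * t)) =
      heatKernel t x * (x i ^ 2 / (4 * t)) * (1 / t) - heatKernel t x * (1 / (2 * t)) := by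
    field_simp
  have b0 : heatKernel t x * (x i ^ 2 / (4 * t)) ≤ A := le_trans (by gcongr) h2
  have b1 : heatKernel t x * (x i ^ 2 / (4 * t)) * (1 / t) ≤ A * (1 / t) := by gcongr
  have b2 : heatKernel t x * (1 / (2 * t)) ≤ A * (1 / t) := by gcongr; linarith
  have b3 : 0 ≤ heatKernel t x * (x i ^ 2 / (4 * t)) * (1 / t) := by positivity
  have b4 : 0 ≤ heatKernel t x * (1 / (2 * t)) := by positivity
  have e2 : A * (2 / t) = A * (1 / t) + A * (1 / t) := by ring
  rw [e1, e2, abs_le]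
  constructor <;> linarith

/-- The convolution of `f` with the unnormalized heat kernel. -/
noncomputable def heatConv (f : EuclideanSpace ℝ (Fin N) → ℝ) (t : ℝ)
    (x : EuclideanSpace ℝ (Fin N)) : ℝ :=
  ∫ y, f y * heatKernel t (x - y)

variable {f : EuclideanSpace ℝ (Fin N) → ℝ}

theorem integrable_mul_of_continuous_of_bound (hf : Integrable f)
    {k : EuclideanSpace ℝ (Fin N) → ℝ} (hk : Continuous k) {C : ℝ} (hC : ∀ y, |k y| ≤ C) :
    Integrable (fun y => f y * k y) := by
  simpa [mul_comm] using hf.bdd_mul hk.aestronglyMeasurable (Eventually.of_forall hC)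

theorem integrable_mul_heatKernel (hf : Integrable f) {t : ℝ} (ht : 0 < t)
    (x : EuclideanSpace ℝ (Fin N)) : Integrable (fun y => f y * heatKernel t (x - y)) :=
  integrable_mul_of_continuous_of_bound hf
    ((continuous_heatKernel t).comp (continuous_const.sub continuous_id)) fun y => by
      rw [abs_of_nonneg (heatKernel_nonneg ht _)]
      exact heatKernel_le ht le_rfl _

theorem heatConv_nonneg (hf : ∀ y, 0 ≤ f y) {t : ℝ} (ht : 0 < t)
    (x : EuclideanSpace ℝ (Fin N)) : 0 ≤ heatConv f t x :=
  integral_nonneg fun y => mul_nonneg (hf y) (heatKernel_nonneg ht _)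

theorem heatConv_le (hf : Integrable f) (hf0 : ∀ y, 0 ≤ f y) {s t : ℝ} (hs : 0 < s)
    (hst : s ≤ t) (x : EuclideanSpace ℝ (Fin N)) :
    heatConv f t x ≤ s ^ (-((N : ℝ) / 2)) * ∫ y, f y := by
  rw [← integral_const_mul]
  refine integral_mono (integrable_mul_heatKernel hf (hs.trans_le hst) x) (hf.const_mul _)
    fun y => ?_
  rw [mul_comm]
  exact mul_le_mul_of_nonneg_right (heatKernel_le hs hst _) (hf0 y)

theorem continuousOn_heatConv (hf : Integrable f) {s : ℝ} (hs : 0 < s) :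
    ContinuousOn (fun z : ℝ × EuclideanSpace ℝ (Fin N) => heatConv f z.1 z.2)
      (Ici s ×ˢ univ) := by
  unfold heatConv
  refine continuousOn_of_dominated (bound := fun y => |f y| * s ^ (-((N : ℝ) / 2))) ?_ ?_
    (hf.abs.mul_const _) ?_
  · rintro ⟨t, x⟩ ⟨ht, -⟩
    exact (integrable_mul_heatKernel hf (hs.trans_le ht) x).aestronglyMeasurable
  · rintro ⟨t, x⟩ ⟨ht, -⟩
    refine Eventually.of_forall fun y => ?_
    rw [norm_mul, Real.norm_eq_abs, Real.norm_eq_abs,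
      abs_of_nonneg (heatKernel_nonneg (hs.trans_le ht) _)]
    exact mul_le_mul_of_nonneg_left (heatKernel_le hs ht _) (abs_nonneg _)
  · refine Eventually.of_forall fun y => ?_
    unfold heatKernel
    refine continuousOn_const.mul (ContinuousOn.mul ?_ ?_)
    · exact continuousOn_fst.rpow_const fun z hz => Or.inl (hs.trans_le hz.1).ne'
    · refine (ContinuousOn.neg (ContinuousOn.div (by fun_prop) (by fun_prop) fun z hz => ?_)).rexp
      exact mul_ne_zero four_ne_zero (hs.trans_le hz.1).ne'

/-- The convolution with the heat kernel solves the heat equation. -/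
theorem heatConv_heat_equation (hf : Integrable f) {t : ℝ} (ht : 0 < t)
    (x : EuclideanSpace ℝ (Fin N)) :
    ∃ L, HasDerivAt (fun s => heatConv f s x) L t ∧ HasLaplacianAt (heatConv f t) x L := by
  have hK : ∀ c : ℝ, 0 < c → ∀ y : EuclideanSpace ℝ (Fin N), |heatKernel c y| ≤
      c ^ (-((N : ℝ) / 2)) := fun c hc y => by
    rw [abs_of_nonneg (heatKernel_nonneg hc y)]
    exact heatKernel_le hc le_rfl y
  have hcK : Continuous fun y : EuclideanSpace ℝ (Fin N) => heatKernel t (x - y) :=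
    (continuous_heatKernel t).comp (continuous_const.sub continuous_id)
  refine ⟨∫ y, f y * (heatKernel t (x - y) * (‖x - y‖ ^ 2 / (4 * t ^ 2) - N / (2 * t))), ?_,
    fun i => ∫ y, f y * (heatKernel t (x - y) * ((x - y) i ^ 2 / (4 * t ^ 2) - 1 / (2 * t))),
    fun i => ?_, ?_⟩
  · have ht2 : 0 < t / 2 := by positivity
    refine (hasDerivAt_integral_of_dominated_loc_of_deriv_le (Ioi_mem_nhds (half_lt_self ht))
      (F := fun s y => f y * heatKernel s (x - y))
      (F' := fun s y => f y * (heatKernel s (x - y) * (‖x - y‖ ^ 2 / (4 * s ^ 2) - N / (2 * s))))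
      (bound := fun y => |f y| * ((t / 2) ^ (-((N : ℝ) / 2)) * ((1 + N) / (t / 2))))
      ?_ (integrable_mul_heatKernel hf ht x) ?_ ?_ (hf.abs.mul_const _) ?_).2
    · filter_upwards [Ioi_mem_nhds ht] with s hs
      exact (integrable_mul_heatKernel hf hs x).aestronglyMeasurable
    · exact hf.aestronglyMeasurable.mul
        (hcK.mul (by fun_prop)).aestronglyMeasurable
    · refine Eventually.of_forall fun y s hs => ?_
      rw [norm_mul, Real.norm_eq_abs, Real.norm_eq_abs]
      exact mul_le_mul_of_nonneg_left (abs_heatKernel_time_deriv_le ht2 (le_of_lt hs) _)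
        (abs_nonneg _)
    · exact Eventually.of_forall fun y s hs =>
        (hasDerivAt_heatKernel_time (ht2.trans hs) (x - y)).const_mul (f y)
  · set e := EuclideanSpace.basisFun (Fin N) ℝ i with he
    have hline : ∀ (s : ℝ) (y : EuclideanSpace ℝ (Fin N)), x + s • e - y = (x - y) + s • e :=
      fun s y => by abel
    have hcoord : ∀ (s : ℝ) (z : EuclideanSpace ℝ (Fin N)), (z + s • e) i = z i + s :=
      fun s z => by simp [he]
    have hcl : ∀ s : ℝ, Continuous fun y : EuclideanSpace ℝ (Fin N) =>
        heatKernel t (x - y + s • e) := fun s => (continuous_heatKernel t).comp (by fun_prop)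
    refine ⟨fun s => ∫ y, f y * (heatKernel t (x - y + s • e) * (-((x - y) i + s) / (2 * t))),
      Eventually.of_forall fun s => ?_, ?_⟩
    · refine (hasDerivAt_integral_of_dominated_loc_of_deriv_le univ_mem
        (F := fun (s : ℝ) y => f y * heatKernel t (x + s • e - y))
        (F' := fun (s : ℝ) y => f y * (heatKernel t (x - y + s • e) *
          (-((x - y) i + s) / (2 * t))))
        (bound := fun y => |f y| * (t ^ (-((N : ℝ) / 2)) * (1 / (2 * t) + 2)))
        ?_ (integrable_mul_heatKernel hf ht _) ?_ ?_ (hf.abs.mul_const _) ?_).2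
      · exact Eventually.of_forall fun s =>
          (integrable_mul_heatKernel hf ht _).aestronglyMeasurable
      · exact hf.aestronglyMeasurable.mul
          ((hcl s).mul (by fun_prop)).aestronglyMeasurable
      · refine Eventually.of_forall fun y s _ => ?_
        rw [norm_mul, Real.norm_eq_abs, Real.norm_eq_abs, ← hcoord]
        exact mul_le_mul_of_nonneg_left (abs_heatKernel_line_deriv_le ht _ i) (abs_nonneg _)
      · refine Eventually.of_forall fun y s _ => ?_
        simp only [hline]
        exact (hasDerivAt_heatKernel_line t (x - y) i s).const_mul (f y)
    · have h := (hasDerivAt_integral_of_dominated_loc_of_deriv_le (x₀ := (0 : ℝ)) (μ := volume)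
        univ_mem
        (F := fun (s : ℝ) y => f y * (heatKernel t (x - y + s • e) *
          (-((x - y) i + s) / (2 * t))))
        (F' := fun (s : ℝ) y => f y * (heatKernel t (x - y + s • e) *
          (((x - y) i + s) ^ 2 / (4 * t ^ 2) - 1 / (2 * t))))
        (bound := fun y => |f y| * (t ^ (-((N : ℝ) / 2)) * (2 / t)))
        ?_ ?_ ?_ ?_ (hf.abs.mul_const _) ?_).2
      · simpa using h
      · exact Eventually.of_forall fun s => hf.aestronglyMeasurable.mul
          ((hcl s).mul (by fun_prop)).aestronglyMeasurable
      · refine integrable_mul_of_continuous_of_bound hf ((hcl 0).mul (by fun_prop))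
          (C := t ^ (-((N : ℝ) / 2)) * (1 / (2 * t) + 2)) fun y => ?_
        rw [← hcoord]
        exact abs_heatKernel_line_deriv_le ht _ i
      · exact hf.aestronglyMeasurable.mul
          ((hcl 0).mul (by fun_prop)).aestronglyMeasurable
      · refine Eventually.of_forall fun y s _ => ?_
        rw [norm_mul, Real.norm_eq_abs, Real.norm_eq_abs, ← hcoord]
        exact mul_le_mul_of_nonneg_left (abs_heatKernel_line_deriv_two_le ht _ i) (abs_nonneg _)
      · exact Eventually.of_forall fun y s _ =>
          (hasDerivAt_heatKernel_line_deriv t (x - y) i s).const_mul (f y)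
  · rw [← integral_finsetSum]
    · refine integral_congr_ae (Eventually.of_forall fun y => ?_)
      simp only
      rw [← Finset.mul_sum, ← Finset.mul_sum, Finset.sum_sub_distrib, ← Finset.sum_div,
        ← EuclideanSpace.real_norm_sq_eq]
      simp
      ring_nf
      tauto
    · intro i _
      exact integrable_mul_of_continuous_of_bound hf (hcK.mul (by fun_prop))
        fun y => abs_heatKernel_line_deriv_two_le ht _ i

/-- The convolution with the heat kernel at time `s` controls `f` from below at the scale `√s`. -/
theorem le_heatConv (hf : Integrable f) (hf0 : ∀ y, 0 ≤ f y) {r m : ℝ} (hr : 0 < r)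
    (x : EuclideanSpace ℝ (Fin N)) (hm : ∀ y ∈ Metric.ball x r, m ≤ f y) :
    m * (Real.exp (-(1 / 4)) * volume.real (Metric.ball (0 : EuclideanSpace ℝ (Fin N)) 1)) ≤
      heatConv f (r ^ 2) x := by
  have hr2 : 0 < r ^ 2 := by positivity
  rcases le_or_gt m 0 with hm0 | hm0
  · exact (mul_nonpos_of_nonpos_of_nonneg hm0 (by positivity)).trans (heatConv_nonneg hf0 hr2 x)
  have hint := integrable_mul_heatKernel hf hr2 x
  have hrpow : (r ^ 2) ^ (-((N : ℝ) / 2)) = (r ^ N)⁻¹ := by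
    rw [← Real.rpow_natCast r 2, ← Real.rpow_mul hr.le, ← Real.rpow_natCast, ← Real.rpow_neg hr.le]
    congr 1
    push_cast
    ring
  have hvol : volume.real (Metric.ball x r) =
      r ^ N * volume.real (Metric.ball (0 : EuclideanSpace ℝ (Fin N)) 1) := by
    simp only [Measure.real]
    rw [Measure.addHaar_ball_of_pos _ x hr, ENNReal.toReal_mul, ENNReal.toReal_ofReal (by positivity)]
    simp
  calc m * (Real.exp (-(1 / 4)) * volume.real (Metric.ball (0 : EuclideanSpace ℝ (Fin N)) 1))
      = ∫ y in Metric.ball x r, m * ((r ^ N)⁻¹ * Real.exp (-(1 / 4))) := by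
        rw [setIntegral_const, hvol, smul_eq_mul]
        have : r ^ N ≠ 0 := by positivity
        field_simp
    _ ≤ ∫ y in Metric.ball x r, f y * heatKernel (r ^ 2) (x - y) := by
        refine setIntegral_mono_on ?_ hint.integrableOn measurableSet_ball fun y hy => ?_
        · exact integrableOn_const measure_ball_lt_top.ne
        · unfold heatKernel
          rw [hrpow]
          have hxy : ‖x - y‖ ≤ r := by
            rw [← dist_eq_norm, dist_comm]; exact (Metric.mem_ball.1 hy).le
          have hexp : ‖x - y‖ ^ 2 / (4 * r ^ 2) ≤ 1 / 4 := by
            rw [div_le_iff₀ (by positivity)]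
            nlinarith [norm_nonneg (x - y)]
          have := hm y hy
          gcongr
          exact hf0 y
    _ ≤ heatConv f (r ^ 2) x :=
        setIntegral_le_integral hint (Eventually.of_forall fun y =>
          mul_nonneg (hf0 y) (heatKernel_nonneg hr2 _))

end HeatKernel

section Barriers

variable {N : ℕ}

theorem hasLaplacianAt_norm_sq_pow (m : ℕ) (b x : EuclideanSpace ℝ (Fin N)) :
    HasLaplacianAt (fun y => (‖y - b‖ ^ 2) ^ m) x
      (4 * m * (m - 1 : ℕ) * ((‖x - b‖ ^ 2) ^ (m - 2) * ‖x - b‖ ^ 2) +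
        2 * m * N * (‖x - b‖ ^ 2) ^ (m - 1)) := by
  refine ⟨fun i => 4 * m * (m - 1 : ℕ) * ((‖x - b‖ ^ 2) ^ (m - 2) * (x - b) i ^ 2) +
    2 * m * (‖x - b‖ ^ 2) ^ (m - 1), fun i => ?_, ?_⟩
  · set e := EuclideanSpace.basisFun (Fin N) ℝ i with he
    have hsq : ∀ s : ℝ, HasDerivAt (fun s : ℝ => ‖x + s • e - b‖ ^ 2) (2 * ((x - b) i + s)) s := by
      intro s
      have hline : HasDerivAt (fun s : ℝ => x + s • e - b) e s := by
        simpa using (((hasDerivAt_id s).smul_const e).const_add x).sub_const b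
      refine hline.norm_sq.congr_deriv ?_
      congr 1
      simp [he, inner_add_left, inner_sub_left, EuclideanSpace.inner_single_right,
        inner_smul_left]
      ring
    refine ⟨fun s => m * (‖x + s • e - b‖ ^ 2) ^ (m - 1) * (2 * ((x - b) i + s)),
      Eventually.of_forall fun s => (hsq s).pow m, ?_⟩
    have hlin : HasDerivAt (fun s : ℝ => 2 * ((x - b) i + s)) (2 * 1) 0 :=
      ((hasDerivAt_id (0 : ℝ)).const_add _).const_mul 2
    refine ((((hsq 0).pow (m - 1)).const_mul (m : ℝ)).mul hlin).congr_deriv ?_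
    rw [Nat.sub_sub]
    simp only [Pi.pow_apply, zero_smul, add_zero, Nat.reduceAdd]
    ring
  · rw [Finset.sum_add_distrib, ← Finset.mul_sum, ← Finset.mul_sum,
      ← EuclideanSpace.real_norm_sq_eq]
    simp
    ring

theorem type_one_bound_rpow {p M τ : ℝ} (hp : 1 < p) (hM : 0 < M) (hτ : 0 < τ) :
    (M * τ ^ (-(1 / (p - 1)))) ^ (p - 1) = M ^ (p - 1) * τ⁻¹ := by
  have hp' : p - 1 ≠ 0 := by linarith
  rw [Real.mul_rpow hM.le (by positivity), ← Real.rpow_mul hτ.le]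
  congr 1
  rw [show -(1 / (p - 1)) * (p - 1) = -1 by field_simp, Real.rpow_neg_one]

/-- The pointwise inequality which makes the polynomial barrier a strict supersolution. -/
theorem barrier_inequality {p M δ τ g Y c : ℝ} {n : ℕ} (hp : 1 < p) (hM : 0 < M) (hδ : 0 < δ)
    (hδ' : (3 * δ) ^ (p - 1) * 3 < 1) (hn : 6 * M ^ (p - 1) ≤ n + 1) (hc : 0 ≤ c) (hτ : 0 < τ)
    (hg : 1 ≤ g) (hg' : g ≤ 2) (hY : 0 ≤ Y)
    (hz : δ * (g + τ * Y ^ (n + 2)) ≤ M * τ ^ (-(1 / (p - 1)))) :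
    (δ * (g + τ * Y ^ (n + 2))) ^ (p - 1) * (δ * (g + τ * Y ^ (n + 2))) <
      δ * (1 + c * (2 * c) ^ (n + 1) + (n + 1) * Y ^ (n + 2)) - δ * (c * Y ^ (n + 1)) := by
  have hYn : 0 ≤ Y ^ (n + 2) := by positivity
  have hp1 : 0 ≤ p - 1 := by linarith
  have hlow : δ * (1 + (n + 1) / 2 * Y ^ (n + 2)) ≤
      δ * (1 + c * (2 * c) ^ (n + 1) + (n + 1) * Y ^ (n + 2)) - δ * (c * Y ^ (n + 1)) := by
    rw [← mul_sub]
    refine mul_le_mul_of_nonneg_left ?_ hδ.le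
    rcases le_total Y (2 * c) with h | h
    · have h1 : c * Y ^ (n + 1) ≤ c * (2 * c) ^ (n + 1) := by gcongr
      have h2 : (n + 1 : ℝ) / 2 * Y ^ (n + 2) ≤ (n + 1) * Y ^ (n + 2) := by
        gcongr; linarith [(Nat.cast_nonneg n : (0 : ℝ) ≤ n)]
      linarith
    · have h0 : 0 ≤ c * (2 * c) ^ (n + 1) := by positivity
      have h1 : 2 * c * Y ^ (n + 1) ≤ Y ^ (n + 2) := by
        rw [pow_succ Y (n + 1), mul_comm (Y ^ (n + 1))]; gcongr
      have h2 : 0 ≤ (n : ℝ) * Y ^ (n + 2) := by positivity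
      linarith
  refine lt_of_lt_of_le ?_ hlow
  set z := δ * (g + τ * Y ^ (n + 2)) with hzdef
  have hz0 : 0 ≤ z := by positivity
  rcases le_total (τ * Y ^ (n + 2)) 1 with h | h
  · have hz3 : z ≤ 3 * δ := by
      rw [hzdef, mul_comm]; gcongr; linarith
    calc z ^ (p - 1) * z ≤ (3 * δ) ^ (p - 1) * (3 * δ) := by gcongr
      _ = (3 * δ) ^ (p - 1) * 3 * δ := by ring
      _ < 1 * δ := by gcongr
      _ ≤ δ * (1 + (n + 1) / 2 * Y ^ (n + 2)) := by
        have : 0 ≤ δ * ((n + 1) / 2 * Y ^ (n + 2)) := by positivity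
        linarith
  · have hz3 : z ≤ 3 * (δ * (τ * Y ^ (n + 2))) := by
      have : δ * (g + τ * Y ^ (n + 2)) ≤ δ * (3 * (τ * Y ^ (n + 2))) := by gcongr; linarith
      linarith
    have hzp : z ^ (p - 1) ≤ M ^ (p - 1) * τ⁻¹ := by
      rw [← type_one_bound_rpow hp hM hτ]
      gcongr
    calc z ^ (p - 1) * z ≤ (M ^ (p - 1) * τ⁻¹) * (3 * (δ * (τ * Y ^ (n + 2)))) := by gcongr
      _ = δ * (3 * M ^ (p - 1) * Y ^ (n + 2)) := by field_simp
      _ < δ * (1 + (n + 1) / 2 * Y ^ (n + 2)) := by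
        refine mul_lt_mul_of_pos_left ?_ hδ
        have : 3 * M ^ (p - 1) * Y ^ (n + 2) ≤ (n + 1) / 2 * Y ^ (n + 2) := by
          gcongr; linarith
        linarith

/-- If a type I solution is small on a unit ball at a time close enough to `1`, then it remains
small at the centre of the ball. -/
theorem exists_abs_le_at_center (N : ℕ) {p M : ℝ} (hp : 1 < p) (hM : 0 < M) :
    ∃ δ > (0 : ℝ), ∃ h > (0 : ℝ), h < 1 ∧ ∀ (Ω : Set (EuclideanSpace ℝ (Fin N)))
      (v : ℝ → EuclideanSpace ℝ (Fin N) → ℝ), IsTypeISolution p M Ω v →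
      ∀ b ∈ closure Ω, (∀ x ∈ Metric.closedBall b 1, x ∈ closure Ω → |v (1 - h) x| < δ) →
        ∀ t ∈ Ico (1 - h) 1, |v t b| ≤ 2 * δ := by
  have hp1 : 0 < p - 1 := by linarith
  obtain ⟨n, hn⟩ := exists_nat_ge (max (6 * M ^ (p - 1)) (1 / (p - 1)))
  have hn1 : 6 * M ^ (p - 1) ≤ n + 1 := by linarith [(le_max_left _ _).trans hn]
  have hn2 : 1 / (p - 1) ≤ n := (le_max_right _ _).trans hn
  obtain ⟨δ, hδ, hδ'⟩ : ∃ δ > (0 : ℝ), (3 * δ) ^ (p - 1) * 3 < 1 := by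
    have hc : ContinuousAt (fun δ : ℝ => (3 * δ) ^ (p - 1) * 3) 0 := by
      refine ContinuousAt.mul (ContinuousAt.rpow_const (by fun_prop) (Or.inr hp1.le)) (by fun_prop)
    have h0 : (3 * (0 : ℝ)) ^ (p - 1) * 3 < 1 := by
      rw [mul_zero, Real.zero_rpow hp1.ne']; norm_num
    have hev := hc.eventually (gt_mem_nhds h0)
    obtain ⟨δ, h1, h2⟩ := ((hev.filter_mono nhdsWithin_le_nhds).and
      (self_mem_nhdsWithin (s := Ioi (0 : ℝ)))).exists
    exact ⟨δ, h2, h1⟩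
  set c : ℝ := 4 * (n + 2) * (n + 1) + 2 * (n + 2) * N with hc
  have hc0 : 0 ≤ c := by positivity
  set C : ℝ := 1 + c * (2 * c) ^ (n + 1) with hC
  have hC0 : 0 < C := by positivity
  obtain ⟨h, hh0, hh1, hhC, hhM⟩ : ∃ h : ℝ, 0 < h ∧ h < 1 ∧ C * h ≤ 1 ∧ M * h ≤ δ := by
    refine ⟨min (1 / 2) (min (1 / C) (δ / M)), by positivity, ?_, ?_, ?_⟩
    · exact (min_le_left _ _).trans_lt (by norm_num)
    · rw [mul_comm, ← le_div_iff₀ hC0]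
      exact (min_le_right _ _).trans (min_le_left _ _)
    · rw [mul_comm, ← le_div_iff₀ hM]
      exact (min_le_right _ _).trans (min_le_right _ _)
  refine ⟨δ, hδ, h, hh0, hh1, fun Ω v hv b hb hsmall t₁ ht₁ => ?_⟩
  set z : ℝ → EuclideanSpace ℝ (Fin N) → ℝ := fun t x =>
    δ * (1 + C * (t - (1 - h)) + ((1 - t)⁻¹) ^ (n + 1) * (‖x - b‖ ^ 2) ^ (n + 2)) with hz
  have hlt := hv.abs_lt_of_strict_supersolution (z := z) (t₀ := 1 - h) (t₁ := t₁) (b := b) (R := 1)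
    (by linarith) ht₁.2 ?_ ?_ ?_ ?_ ?_ t₁ ⟨ht₁.1, le_rfl⟩ b (by simp) hb
  · refine hlt.le.trans ?_
    have h1 : C * (t₁ - (1 - h)) ≤ 1 := le_trans (by gcongr; linarith [ht₁.2]) hhC
    simp only [hz, sub_self, norm_zero]
    rw [mul_comm]
    gcongr
    simp
    linarith
  · simp only [hz]
    refine continuousOn_const.mul (ContinuousOn.add (by fun_prop) (ContinuousOn.mul ?_ (by fun_prop)))
    refine ContinuousOn.pow (ContinuousOn.inv₀ (by fun_prop) ?_) _
    rintro ⟨t, x⟩ ⟨ht, -⟩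
    have h1 : t < 1 := ht.2.trans_lt ht₁.2
    exact (sub_pos.2 h1).ne'
  · intro t ht x _
    have h1 : 0 < 1 - t := sub_pos.2 (ht.2.trans_lt ht₁.2)
    have h2 : 0 ≤ t - (1 - h) := by linarith [ht.1]
    positivity
  · intro x hx hxΩ
    refine (hsmall x hx hxΩ).trans_le ?_
    have h1 : 0 ≤ ((1 - (1 - h))⁻¹) ^ (n + 1) * (‖x - b‖ ^ 2) ^ (n + 2) := by
      rw [sub_sub_cancel]; positivity
    simp only [hz, sub_self, mul_zero, add_zero]
    exact le_mul_of_one_le_right hδ.le (by linarith)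
  · intro t ht x hx
    have hτ : 0 < 1 - t := sub_pos.2 (ht.2.trans_lt ht₁.2)
    have h2 : 0 ≤ t - (1 - h) := by linarith [ht.1]
    have hx1 : ‖x - b‖ = 1 := by rw [← dist_eq_norm]; exact hx
    simp only [hz, hx1, one_pow, mul_one]
    have h3 : (1 - t) ^ (-(1 / (p - 1))) ≤ ((1 - t)⁻¹) ^ n := by
      rw [inv_pow, ← Real.rpow_natCast, ← Real.rpow_neg hτ.le]
      exact Real.rpow_le_rpow_of_exponent_ge hτ (by linarith [ht.1]) (by linarith)
    have h4 : M ≤ δ * (1 - t)⁻¹ := by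
      rw [← div_eq_mul_inv, le_div_iff₀ hτ]
      exact le_trans (by gcongr; linarith [ht.1]) hhM
    have h5 : 0 < δ * (1 + C * (t - (1 - h))) := by positivity
    calc M * (1 - t) ^ (-(1 / (p - 1))) ≤ (δ * (1 - t)⁻¹) * ((1 - t)⁻¹) ^ n := by gcongr
      _ = δ * ((1 - t)⁻¹) ^ (n + 1) := by ring
      _ < _ := by linarith
  · intro t ht x hx hzle
    have hτ : 0 < 1 - t := sub_pos.2 (ht.2.trans_lt ht₁.2)
    have h2 : 0 ≤ t - (1 - h) := by linarith [ht.1]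
    have hCt : C * (t - (1 - h)) ≤ 1 := le_trans (by gcongr; linarith) hhC
    set Y := (1 - t)⁻¹ * ‖x - b‖ ^ 2 with hY
    have hY0 : 0 ≤ Y := by positivity
    have hzY : z t x = δ * (1 + C * (t - (1 - h)) + (1 - t) * Y ^ (n + 2)) := by
      have hcancel : (1 - t) * ((1 - t)⁻¹) ^ (n + 2) = ((1 - t)⁻¹) ^ (n + 1) := by
        rw [pow_succ' _ (n + 1), mul_inv_cancel_left₀ hτ.ne']
      simp only [hz, hY, mul_pow]
      rw [← mul_assoc (1 - t), hcancel]
    refine ⟨δ * (C + (n + 1) * Y ^ (n + 2)), δ * (c * Y ^ (n + 1)), ?_, ?_, ?_⟩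
    · have hinv : HasDerivAt (fun s : ℝ => (1 - s)⁻¹) (((1 - t)⁻¹) ^ 2) t :=
        (((hasDerivAt_id t).const_sub 1).inv hτ.ne').congr_deriv (by simp)
      have hlin : HasDerivAt (fun s : ℝ => 1 + C * (s - (1 - h))) (C * 1) t :=
        (((hasDerivAt_id t).sub_const (1 - h)).const_mul C).const_add 1
      refine ((hlin.add ((hinv.pow (n + 1)).mul_const ((‖x - b‖ ^ 2) ^ (n + 2)))).const_mul
        δ).congr_deriv ?_
      rw [hY, mul_pow]
      push_cast
      ring_nf
    · have hlap := (((HasLaplacianAt.const (1 + C * (t - (1 - h))) x).add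
        ((hasLaplacianAt_norm_sq_pow (n + 2) b x).const_mul (((1 - t)⁻¹) ^ (n + 1)))).const_mul δ)
      convert hlap using 1
      rw [hY, mul_pow, hc]
      simp only [Nat.add_sub_cancel, show n + 2 - 1 = n + 1 from rfl]
      push_cast
      ring
    · rw [hzY] at hzle ⊢
      exact barrier_inequality hp hM hδ hδ' hn1 hc0 hτ
        (by have : 0 ≤ C * (t - (1 - h)) := by positivity
            linarith) (by linarith) hY0 hzle

theorem continuousOn_heatConv_add {f : EuclideanSpace ℝ (Fin N) → ℝ} (hf : Integrable f) {s : ℝ}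
    (hs : 0 < s) :
    ContinuousOn (fun z : ℝ × EuclideanSpace ℝ (Fin N) => heatConv f (z.1 + s) z.2)
      (Ici 0 ×ˢ univ) :=
  ContinuousOn.comp (g := fun z : ℝ × EuclideanSpace ℝ (Fin N) => heatConv f z.1 z.2)
    (f := fun z : ℝ × EuclideanSpace ℝ (Fin N) => (z.1 + s, z.2)) (continuousOn_heatConv hf hs)
    (by fun_prop) fun z hz => ⟨by simpa using hz.1, mem_univ _⟩

/-- Local smoothing: a type I solution with small initial mass on a large ball is small at a fixed
later time on a smaller ball. -/
theorem exists_small_of_small_mass (N : ℕ) {p M δ h : ℝ} (hp : 1 < p) (hM : 0 < M) (hδ : 0 < δ)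
    (hh : 0 < h) (hh1 : h < 1) :
    ∃ ε > (0 : ℝ), ∃ k > (0 : ℝ), ∀ (Ω : Set (EuclideanSpace ℝ (Fin N)))
      (v : ℝ → EuclideanSpace ℝ (Fin N) → ℝ), IsTypeISolution p M Ω v →
      ∫ x in Ω ∩ Metric.closedBall 0 k, |v 0 x| < ε →
        ∀ x ∈ Metric.closedBall 0 2, x ∈ closure Ω → |v (1 - h) x| < δ := by
  have hp1 : 0 < p - 1 := by linarith
  have hh' : 0 < 1 - h := by linarith
  set M₀ : ℝ := M * h ^ (-(1 / (p - 1))) with hM₀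
  have hM₀0 : 0 < M₀ := by positivity
  set C₀ : ℝ := M₀ ^ (p - 1) + 1 with hC₀
  have hC₀0 : 0 < C₀ := by positivity
  set A : ℝ := Real.exp C₀ with hA
  have hA0 : 0 < A := Real.exp_pos _
  set c : ℝ := Real.exp (-(1 / 4)) * volume.real (Metric.ball (0 : EuclideanSpace ℝ (Fin N)) 1)
    with hc
  have hc0 : 0 < c := mul_pos (Real.exp_pos _)
    (ENNReal.toReal_pos (Metric.measure_ball_pos _ _ one_pos).ne' measure_ball_lt_top.ne)
  set θ : ℝ := δ / (4 * A) with hθ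
  have hθ0 : 0 < θ := by positivity
  set P : ℝ := (1 - h) ^ (-((N : ℝ) / 2)) with hP
  have hP0 : 0 < P := by positivity
  set R : ℝ := max 2 (M₀ * (4 + 2 * N) / θ) with hR
  have hR2 : 2 ≤ R := le_max_left _ _
  have hRθ : M₀ / R ^ 2 * (4 + 2 * N) ≤ θ := by
    have h1 : M₀ * (4 + 2 * N) / θ ≤ R := le_max_right _ _
    have h2 : R ≤ R ^ 2 := by nlinarith
    rw [div_le_iff₀ hθ0] at h1
    rw [div_mul_eq_mul_div, div_le_iff₀ (by positivity)]
    nlinarith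
  refine ⟨θ * c / P, by positivity, R + 1, by positivity, fun Ω v hv hmass x hx hxΩ => ?_⟩
  have h0mem : (0 : ℝ) ∈ Ico (0 : ℝ) 1 := ⟨le_rfl, one_pos⟩
  have hv0 : ContinuousOn (fun x => |v 0 x|) (closure Ω) :=
    (hv.continuousOn.comp (by fun_prop : ContinuousOn (fun x => ((0 : ℝ), x)) (closure Ω))
      fun x hx => ⟨h0mem, hx⟩).abs
  set F : EuclideanSpace ℝ (Fin N) → ℝ := Ω.indicator fun x => |v 0 x| with hF
  have hFcont : Continuous F :=
    continuous_indicator (fun x hx => by simp [hv.boundary 0 h0mem x hx]) hv0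
  have hF0 : ∀ y, 0 ≤ F y := fun y => indicator_nonneg (fun _ _ => abs_nonneg _) y
  have hFeq : ∀ y ∈ closure Ω, F y = |v 0 y| := by
    intro y hy
    by_cases hyΩ : y ∈ Ω
    · simp [hF, hyΩ]
    · have : y ∈ frontier Ω := by rw [hv.isOpen.frontier_eq]; exact ⟨hy, hyΩ⟩
      simp [hF, hyΩ, hv.boundary 0 h0mem y this]
  set f := (Metric.closedBall (0 : EuclideanSpace ℝ (Fin N)) (R + 1)).indicator F with hf
  have hfint : Integrable f :=
    (hFcont.continuousOn.integrableOn_compact (isCompact_closedBall _ _)).integrable_indicator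
      measurableSet_closedBall
  have hf0 : ∀ y, 0 ≤ f y := fun y => indicator_nonneg (fun y _ => hF0 y) y
  have hfmass : ∫ y, f y < θ * c / P := by
    rw [hf, hF, integral_indicator measurableSet_closedBall,
      setIntegral_indicator hv.isOpen.measurableSet, inter_comm]
    exact hmass
  obtain ⟨r, hr0, hr1, hr⟩ : ∃ r : ℝ, 0 < r ∧ r ≤ 1 ∧
      ∀ y ∈ Metric.closedBall (0 : EuclideanSpace ℝ (Fin N)) R, ∀ y' ∈ Metric.ball y r,
        F y - θ / 2 ≤ f y' := by
    obtain ⟨r, hr0, hr⟩ := Metric.uniformContinuousOn_iff.1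
      ((isCompact_closedBall (0 : EuclideanSpace ℝ (Fin N)) (R + 1)).uniformContinuousOn_of_continuous
        hFcont.continuousOn) (θ / 2) (by positivity)
    refine ⟨min r 1, by positivity, min_le_right _ _, fun y hy y' hy' => ?_⟩
    have hd := Metric.mem_ball.1 hy'
    have hy0 := Metric.mem_closedBall.1 hy
    have hyk : y ∈ Metric.closedBall (0 : EuclideanSpace ℝ (Fin N)) (R + 1) :=
      Metric.mem_closedBall.2 (by linarith)
    have hyk' : y' ∈ Metric.closedBall (0 : EuclideanSpace ℝ (Fin N)) (R + 1) :=
      Metric.mem_closedBall.2 (by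
        linarith [dist_triangle y' y 0, hd.trans_le (min_le_right r 1)])
    have := hr y' hyk' y hyk (hd.trans_le (min_le_left _ _))
    rw [Real.dist_eq, abs_lt] at this
    rw [hf, indicator_of_mem hyk']
    linarith [this.1]
  set z : ℝ → EuclideanSpace ℝ (Fin N) → ℝ := fun t x =>
    Real.exp (C₀ * t) * (c⁻¹ * heatConv f (t + r ^ 2) x +
      (θ + M₀ / R ^ 2 * ((‖x - 0‖ ^ 2) ^ 1 + 2 * N * t))) with hz
  have hr2 : 0 < r ^ 2 := by positivity
  have hconv0 : ∀ t, 0 ≤ t → ∀ x, 0 ≤ c⁻¹ * heatConv f (t + r ^ 2) x := fun t ht x =>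
    mul_nonneg (by positivity) (heatConv_nonneg hf0 (by positivity) x)
  have hlt := hv.abs_lt_of_strict_supersolution (z := z) (t₀ := 0) (t₁ := 1 - h) (b := 0) (R := R)
    le_rfl (by linarith) ?_ ?_ ?_ ?_ ?_ (1 - h) ⟨hh'.le, le_rfl⟩ x
    (Metric.closedBall_subset_closedBall hR2 hx) hxΩ
  · refine hlt.trans ?_
    have hx2 : ‖x - 0‖ ^ 2 ≤ 4 := by
      have : ‖x - 0‖ ≤ 2 := by simpa using hx
      nlinarith [norm_nonneg (x - 0)]
    have hexp : Real.exp (C₀ * (1 - h)) ≤ A := Real.exp_le_exp.2 (by nlinarith)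
    have b1 : c⁻¹ * heatConv f (1 - h + r ^ 2) x ≤ θ := by
      have h1 := heatConv_le hfint hf0 hh' (by linarith : 1 - h ≤ 1 - h + r ^ 2) x
      have h2 : P * ∫ y, f y ≤ P * (θ * c / P) := by gcongr
      rw [inv_mul_le_iff₀ hc0]
      refine h1.trans (h2.trans (le_of_eq ?_))
      field_simp
    have b2 : M₀ / R ^ 2 * ((‖x - 0‖ ^ 2) ^ 1 + 2 * N * (1 - h)) ≤ θ := by
      refine le_trans ?_ hRθ
      have h1 : 2 * (N : ℝ) * (1 - h) ≤ 2 * N := mul_le_of_le_one_right (by positivity) (by linarith)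
      rw [pow_one]
      gcongr
    have b3 := hconv0 (1 - h) hh'.le x
    have b4 : 0 ≤ M₀ / R ^ 2 * ((‖x - 0‖ ^ 2) ^ 1 + 2 * N * (1 - h)) := by positivity
    calc z (1 - h) x ≤ A * (θ + (θ + θ)) := by
          simp only [hz]; gcongr
      _ = 3 / 4 * δ := by rw [hθ]; field_simp; ring
      _ < δ := by linarith
  · simp only [hz]
    refine ContinuousOn.mul (by fun_prop) (ContinuousOn.add (continuousOn_const.mul ?_)
      (by fun_prop))
    exact (continuousOn_heatConv_add hfint hr2).mono
      (prod_mono (fun t ht => ht.1) (subset_univ _))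
  · intro t ht y _
    have h1 := hconv0 t ht.1 y
    have ht0 := ht.1
    positivity
  · intro y hy hyΩ
    rw [← hFeq y hyΩ]
    have h1 := le_heatConv hfint hf0 hr0 y (hr y hy)
    rw [← hc] at h1
    have h2 : F y - θ / 2 ≤ c⁻¹ * heatConv f (r ^ 2) y := by
      rw [← div_eq_inv_mul, le_div_iff₀ hc0]; exact h1
    have h3 : 0 ≤ M₀ / R ^ 2 * ((‖y - 0‖ ^ 2) ^ 1 + 2 * N * 0) := by positivity
    simp only [hz, mul_zero, Real.exp_zero, one_mul, zero_add] at h3 ⊢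
    linarith
  · intro t ht y hy
    have h1 := hconv0 t ht.1 y
    have hyR : ‖y - 0‖ = R := by simpa using hy
    have hb : M * (1 - t) ^ (-(1 / (p - 1))) ≤ M₀ := by
      refine mul_le_mul_of_nonneg_left ?_ hM.le
      exact Real.rpow_le_rpow_of_nonpos hh (by linarith [ht.2]) (by simp; linarith)
    have h2 : M₀ ≤ M₀ / R ^ 2 * ((‖y - 0‖ ^ 2) ^ 1 + 2 * N * t) := by
      have : 0 ≤ 2 * N * t := mul_nonneg (by positivity) ht.1
      rw [hyR, pow_one, mul_add, div_mul_cancel₀ _ (by positivity)]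
      have : 0 ≤ M₀ / R ^ 2 * (2 * N * t) := by positivity
      linarith
    have h3 : 1 ≤ Real.exp (C₀ * t) := Real.one_le_exp (mul_nonneg hC₀0.le ht.1)
    have h4 : M₀ < c⁻¹ * heatConv f (t + r ^ 2) y +
        (θ + M₀ / R ^ 2 * ((‖y - 0‖ ^ 2) ^ 1 + 2 * N * t)) := by linarith
    calc _ ≤ M₀ := hb
      _ < _ := h4
      _ ≤ z t y := le_mul_of_one_le_left (by linarith) h3
  · intro t ht y _ hzle
    have ht0 := ht.1
    have h1 := hconv0 t ht0.le y
    have hzpos : 0 < z t y := by simp only [hz]; positivity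
    have hb : M * (1 - t) ^ (-(1 / (p - 1))) ≤ M₀ := by
      refine mul_le_mul_of_nonneg_left ?_ hM.le
      exact Real.rpow_le_rpow_of_nonpos hh (by linarith [ht.2]) (by simp; linarith)
    obtain ⟨L, hL1, hL2⟩ := heatConv_heat_equation hfint (by positivity : 0 < t + r ^ 2) y
    refine ⟨C₀ * z t y + Real.exp (C₀ * t) * (c⁻¹ * L + M₀ / R ^ 2 * (2 * N)),
      Real.exp (C₀ * t) * (c⁻¹ * L + M₀ / R ^ 2 * (2 * N)), ?_, ?_, ?_⟩
    · have hexp : HasDerivAt (fun s => Real.exp (C₀ * s)) (Real.exp (C₀ * t) * (C₀ * 1)) t :=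
        ((hasDerivAt_id t).const_mul C₀).exp
      have hcv : HasDerivAt (fun s => heatConv f (s + r ^ 2) y) L t :=
        hL1.comp_add_const t (r ^ 2)
      have hq : HasDerivAt (fun s : ℝ => θ + M₀ / R ^ 2 * ((‖y - 0‖ ^ 2) ^ 1 + 2 * N * s))
          (M₀ / R ^ 2 * (2 * N * 1)) t :=
        ((((hasDerivAt_id t).const_mul (2 * N : ℝ)).const_add _).const_mul _).const_add _
      refine (hexp.mul ((hcv.const_mul c⁻¹).add hq)).congr_deriv ?_
      simp only [hz, Pi.add_apply]
      ring
    · have hq := ((hasLaplacianAt_norm_sq_pow 1 0 y).add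
        (HasLaplacianAt.const (2 * N * t) y)).const_mul (M₀ / R ^ 2)
      have hl := ((hL2.const_mul c⁻¹).add ((HasLaplacianAt.const θ y).add hq)).const_mul
        (Real.exp (C₀ * t))
      convert hl using 1
      simp
    · have h2 : z t y ^ (p - 1) ≤ M₀ ^ (p - 1) :=
        Real.rpow_le_rpow hzpos.le (hzle.trans hb) hp1.le
      have h3 : z t y ^ (p - 1) * z t y ≤ M₀ ^ (p - 1) * z t y := by gcongr
      rw [hC₀]
      linarith

end Barriers

/-- A type I solution with small initial mass on a large ball stays bounded near the centre. -/
theorem exists_bounded_of_small_mass (N : ℕ) {p M : ℝ} (hp : 1 < p) (hM : 0 < M) :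
    ∃ ε > (0 : ℝ), ∃ k > (0 : ℝ), ∃ h > (0 : ℝ), ∃ B : ℝ, h < 1 ∧
      ∀ (Ω : Set (EuclideanSpace ℝ (Fin N))) (v : ℝ → EuclideanSpace ℝ (Fin N) → ℝ),
      IsTypeISolution p M Ω v → ∫ x in Ω ∩ Metric.closedBall 0 k, |v 0 x| < ε →
        ∀ t ∈ Ico (1 - h) 1, ∀ x ∈ Ω ∩ Metric.ball 0 1, |v t x| ≤ B := by
  obtain ⟨δ, hδ, h, hh, hh1, hcenter⟩ := exists_abs_le_at_center N hp hM
  obtain ⟨ε, hε, k, hk, hsmall⟩ := exists_small_of_small_mass N hp hM hδ hh hh1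
  refine ⟨ε, hε, k, hk, h, hh, 2 * δ, hh1, fun Ω v hv hmass t ht x hx => ?_⟩
  refine hcenter Ω v hv x (subset_closure hx.1) (fun y hy hyΩ => ?_) t ht
  refine hsmall Ω v hv hmass y (Metric.mem_closedBall.2 ?_) hyΩ
  have h1 := Metric.mem_closedBall.1 hy
  have h2 := Metric.mem_ball.1 hx.2
  linarith [dist_triangle y x 0]

section Solution

variable {N : ℕ} {p M T : ℝ} {Ω : Set (EuclideanSpace ℝ (Fin N))}
  {u₀ : EuclideanSpace ℝ (Fin N) → ℝ} {u : ℝ → EuclideanSpace ℝ (Fin N) → ℝ}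
  {a : EuclideanSpace ℝ (Fin N)}

theorem TypeIEstimate.ae_le (hu : TypeIEstimate p Ω T M u) (hM : 0 < M) {t : ℝ}
    (ht : t ∈ Ico 0 T) :
    ∀ᵐ x ∂volume.restrict Ω, |u t x| ≤ M * (T - t) ^ (-(1 / (p - 1))) := by
  have hτ : 0 < T - t := sub_pos.2 ht.2
  have h := hu t ht
  rw [eLpNorm_exponent_top] at h
  filter_upwards [ae_le_eLpNormEssSup (f := u t) (μ := volume.restrict Ω)] with x hx
  have h2 := hx.trans h
  rw [Real.enorm_eq_ofReal_abs, ENNReal.ofReal_le_ofReal_iff (by positivity)] at h2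
  exact h2

theorem IsClassicalSolution.continuousOn_time_slice (hu : IsClassicalSolution p Ω u₀ T u) {t : ℝ}
    (ht : t ∈ Ioo 0 T) : ContinuousOn (u t) (closure Ω) :=
  hu.continuousOn_closure.comp (by fun_prop : ContinuousOn (fun x => (t, x)) (closure Ω))
    fun _ hx => ⟨ht, hx⟩

theorem IsClassicalSolution.abs_le (hu : IsClassicalSolution p Ω u₀ T u) (hΩ : IsOpen Ω)
    (hI : TypeIEstimate p Ω T M u) (hM : 0 < M) {t : ℝ} (ht : t ∈ Ioo 0 T)
    {x : EuclideanSpace ℝ (Fin N)} (hx : x ∈ closure Ω) :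
    |u t x| ≤ M * (T - t) ^ (-(1 / (p - 1))) := by
  have hτ : 0 < T - t := sub_pos.2 ht.2
  by_cases hxΩ : x ∈ Ω
  · set B := M * (T - t) ^ (-(1 / (p - 1)))
    have hopen : IsOpen (Ω ∩ (fun y => |u t y|) ⁻¹' Ioi B) :=
      ((hu.continuousOn_time_slice ht).mono subset_closure).abs.isOpen_inter_preimage hΩ isOpen_Ioi
    have hnull : volume (Ω ∩ (fun y => |u t y|) ⁻¹' Ioi B) = 0 := by
      have h := hI.ae_le hM ⟨ht.1.le, ht.2⟩
      rw [ae_restrict_iff' hΩ.measurableSet] at h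
      refine measure_mono_null ?_ h
      rintro y ⟨hy, hyB⟩ hcon
      exact absurd (hcon hy) (not_le.2 hyB)
    have hempty := hopen.eq_empty_of_measure_zero hnull
    by_contra! hlt
    have : x ∈ Ω ∩ (fun y => |u t y|) ⁻¹' Ioi B := ⟨hxΩ, hlt⟩
    rw [hempty] at this
    exact this
  · have hf : x ∈ frontier Ω := by rw [hΩ.frontier_eq]; exact ⟨hx, hxΩ⟩
    rw [hu.boundary t ht x hf, abs_zero]
    positivity

theorem IsClassicalSolution.aestronglyMeasurable (hu : IsClassicalSolution p Ω u₀ T u)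
    (hΩ : IsOpen Ω) (hu₀ : MemLp u₀ ⊤ (volume.restrict Ω)) {t : ℝ} (ht : t ∈ Ico 0 T) :
    AEStronglyMeasurable (u t) (volume.restrict Ω) := by
  rcases ht.1.eq_or_lt with rfl | h0
  · exact hu₀.aestronglyMeasurable.congr hu.initial.symm
  · exact ((hu.continuousOn_time_slice ⟨h0, ht.2⟩).mono subset_closure).aestronglyMeasurable
      hΩ.measurableSet

/-- Parabolic rescaling of a type I solution about `(t₁, a)` to the unit time interval. -/
theorem IsClassicalSolution.rescale (hp : 1 < p) (hM : 0 < M)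
    (hu : IsClassicalSolution p Ω u₀ T u) (hΩ : IsOpen Ω) (hI : TypeIEstimate p Ω T M u)
    (a : EuclideanSpace ℝ (Fin N)) {t₁ : ℝ} (ht₁ : t₁ ∈ Ioo 0 T) :
    IsTypeISolution p M ((fun y => a + √(T - t₁) • y) ⁻¹' Ω)
      (fun s y => (T - t₁) ^ (1 / (p - 1)) * u (t₁ + (T - t₁) * s) (a + √(T - t₁) • y)) := by
  set H := T - t₁ with hH
  have hH0 : 0 < H := sub_pos.2 ht₁.2
  have hr0 : √H ≠ 0 := (Real.sqrt_pos.2 hH0).ne'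
  let φ : EuclideanSpace ℝ (Fin N) ≃ₜ EuclideanSpace ℝ (Fin N) :=
    (Homeomorph.smulOfNeZero √H hr0).trans (Homeomorph.addLeft a)
  have hφ : (fun y => a + √H • y) = φ := rfl
  have hcl : closure ((fun y => a + √H • y) ⁻¹' Ω) = (fun y => a + √H • y) ⁻¹' closure Ω := by
    rw [hφ, φ.preimage_closure]
  have hfr : frontier ((fun y => a + √H • y) ⁻¹' Ω) = (fun y => a + √H • y) ⁻¹' frontier Ω := by
    rw [hφ, φ.preimage_frontier]
  have hmem : ∀ s ∈ Ico (0 : ℝ) 1, t₁ + H * s ∈ Ioo 0 T := by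
    rintro s ⟨hs0, hs1⟩
    refine ⟨by nlinarith [ht₁.1], ?_⟩
    have : H * s < H * 1 := by gcongr
    linarith
  have hHp : (H ^ (1 / (p - 1))) ^ (p - 1) = H := by
    have : p - 1 ≠ 0 := by linarith
    rw [← Real.rpow_mul hH0.le, one_div_mul_cancel this, Real.rpow_one]
  have hβ0 : 0 < H ^ (1 / (p - 1)) := by positivity
  refine ⟨hΩ.preimage (by fun_prop), ?_, ?_, ?_, ?_⟩
  · rw [hcl]
    refine continuousOn_const.mul ?_
    exact ContinuousOn.comp (g := fun z : ℝ × EuclideanSpace ℝ (Fin N) => u z.1 z.2)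
      (f := fun z : ℝ × EuclideanSpace ℝ (Fin N) => (t₁ + H * z.1, a + √H • z.2))
      hu.continuousOn_closure (by fun_prop) fun z hz => ⟨hmem z.1 hz.1, hz.2⟩
  · intro s hs y hy
    rw [hfr] at hy
    rw [hu.boundary _ (hmem s hs) _ hy, mul_zero]
  · intro s hs y hy
    rw [hcl] at hy
    have h1 := hu.abs_le hΩ hI hM (hmem s hs) hy
    have hs1 : 0 < 1 - s := sub_pos.2 hs.2
    rw [show T - (t₁ + H * s) = H * (1 - s) by rw [hH]; ring, Real.mul_rpow hH0.le hs1.le] at h1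
    rw [abs_mul, abs_of_pos hβ0]
    calc _ ≤ H ^ (1 / (p - 1)) * (M * (H ^ (-(1 / (p - 1))) * (1 - s) ^ (-(1 / (p - 1))))) := by
          gcongr
      _ = M * (1 - s) ^ (-(1 / (p - 1))) := by
          rw [Real.rpow_neg hH0.le]; field_simp
  · intro s hs y hy
    have ht := hmem s ⟨hs.1.le, hs.2⟩
    set t := t₁ + H * s with ht'
    set x := a + √H • y with hx'
    have hx : x ∈ Ω := hy
    have hlin : HasDerivAt (fun s => t₁ + H * s) (H * 1) s :=
      ((hasDerivAt_id s).const_mul H).const_add t₁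
    have htd : HasDerivAt (fun σ => u σ x) (deriv (fun σ => u σ x) t) (t₁ + H * s) :=
      (hu.differentiableAt_time t ht x hx).hasDerivAt
    have hlap : HasLaplacianAt (u t) (a + √H • y) (Laplacian.laplacian (u t) x) :=
      HasLaplacianAt.of_contDiffAt ((hu.contDiffOn_space t ht).contDiffAt (hΩ.mem_nhds hx))
    refine ⟨_, _, (htd.comp s hlin).const_mul (H ^ (1 / (p - 1))),
      hlap.comp_affine.const_mul (H ^ (1 / (p - 1))), ?_⟩
    rw [hu.equation t ht x hx, Real.sq_sqrt hH0.le, abs_mul, abs_of_pos hβ0,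
      Real.mul_rpow hβ0.le (abs_nonneg _), hHp]
    ring

theorem setIntegral_preimage_affine {S : Set (EuclideanSpace ℝ (Fin N))} (hS : MeasurableSet S)
    (f : EuclideanSpace ℝ (Fin N) → ℝ) (a : EuclideanSpace ℝ (Fin N)) {r : ℝ} (hr : 0 < r) :
    ∫ y in (fun y => a + r • y) ⁻¹' S, f (a + r • y) = (r ^ N)⁻¹ * ∫ x in S, f x := by
  have hmeas : MeasurableSet ((fun y : EuclideanSpace ℝ (Fin N) => a + r • y) ⁻¹' S) :=
    hS.preimage (by fun_prop)
  rw [← integral_indicator hmeas, ← integral_indicator hS]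
  have h1 := Measure.integral_comp_smul_of_nonneg volume
    (fun y : EuclideanSpace ℝ (Fin N) => S.indicator f (a + y)) r (hR := hr.le)
  rw [integral_add_left_eq_self (S.indicator f) a, finrank_euclideanSpace_fin, smul_eq_mul] at h1
  rw [← h1]
  rfl

/-- A function is unbounded near each of its blow-up points. -/
theorem IsBlowUpPoint.not_bounded (ha : IsBlowUpPoint Ω T u a) {r s B : ℝ} (hr : 0 < r)
    (hs : s < T) : ¬ ∀ t ∈ Ico s T, ∀ x ∈ Ω ∩ Metric.ball a r, |u t x| ≤ B := by
  intro hB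
  have hle : limsup (fun z : ℝ × EuclideanSpace ℝ (Fin N) => ‖u z.1 z.2‖ₑ)
      (𝓝[<] T ×ˢ 𝓝[Ω] a) ≤ ENNReal.ofReal B := by
    refine limsup_le_of_le (by isBoundedDefault) ?_
    filter_upwards [prod_mem_prod (Ico_mem_nhdsLT hs)
      (inter_mem_nhdsWithin Ω (Metric.ball_mem_nhds a hr))] with z hz
    rw [Real.enorm_eq_ofReal_abs]
    exact ENNReal.ofReal_le_ofReal (hB z.1 hz.1 z.2 hz.2)
  rw [ha.2] at hle
  exact ENNReal.ofReal_ne_top (top_le_iff.1 hle)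

/-- Concentration of mass at a blow-up point, for positive times. -/
theorem exists_mass_lower_bound (N : ℕ) {p M : ℝ} (hp : 1 < p) (hM : 0 < M) :
    ∃ ε > (0 : ℝ), ∃ k > (0 : ℝ), ∀ (Ω : Set (EuclideanSpace ℝ (Fin N)))
      (u₀ : EuclideanSpace ℝ (Fin N) → ℝ) (T : ℝ) (u : ℝ → EuclideanSpace ℝ (Fin N) → ℝ),
      IsOpen Ω → IsClassicalSolution p Ω u₀ T u → TypeIEstimate p Ω T M u →
      ∀ a, IsBlowUpPoint Ω T u a → ∀ t ∈ Ioo 0 T,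
        ε * ((T - t) ^ (-(1 / (p - 1))) * √(T - t) ^ N) ≤
          ∫ x in Ω ∩ Metric.closedBall a (k * √(T - t)), |u t x| := by
  obtain ⟨ε, hε, k, hk, h, hh, B, hh1, hmain⟩ := exists_bounded_of_small_mass N hp hM
  refine ⟨ε, hε, k, hk, fun Ω u₀ T u hΩ hu hI a ha t ht => ?_⟩
  by_contra! hlt
  have hv := hu.rescale hp hM hΩ hI a ht
  set H := T - t with hH
  have hH0 : 0 < H := sub_pos.2 ht.2
  have hr0 : 0 < √H := Real.sqrt_pos.2 hH0
  have hβ0 : 0 < H ^ (1 / (p - 1)) := by positivity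
  have hset : (fun y => a + √H • y) ⁻¹' Ω ∩ Metric.closedBall 0 k =
      (fun y => a + √H • y) ⁻¹' (Ω ∩ Metric.closedBall a (k * √H)) := by
    ext y
    simp only [mem_inter_iff, mem_preimage, Metric.mem_closedBall, dist_zero_right,
      dist_self_add_left, norm_smul, Real.norm_eq_abs, abs_of_pos hr0]
    rw [mul_comm, mul_le_mul_iff_left₀ hr0]
  have hbdd := hmain _ _ hv ?_
  · refine ha.not_bounded (r := √H) (s := T - h * H) (B := B / H ^ (1 / (p - 1))) hr0
      (by linarith [mul_pos hh hH0]) fun t' ht' x hx => ?_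
    have h1 := hbdd ((t' - t) / H) ⟨?_, ?_⟩ ((√H)⁻¹ • (x - a)) ⟨?_, ?_⟩
    · rw [mul_div_cancel₀ _ hH0.ne', smul_inv_smul₀ hr0.ne', add_sub_cancel, add_sub_cancel,
        abs_mul, abs_of_pos hβ0] at h1
      rw [le_div_iff₀ hβ0, mul_comm]
      exact h1
    · rw [le_div_iff₀ hH0]
      have := ht'.1
      rw [hH] at this ⊢
      linarith
    · rw [div_lt_one hH0, hH]
      linarith [ht'.2]
    · simp only [mem_preimage, smul_inv_smul₀ hr0.ne', add_sub_cancel]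
      exact hx.1
    · rw [Metric.mem_ball, dist_zero_right, norm_smul, norm_inv, Real.norm_eq_abs,
        abs_of_pos hr0, inv_mul_lt_iff₀ hr0, mul_one, ← dist_eq_norm]
      exact hx.2
  · rw [hset]
    simp only [mul_zero, add_zero, abs_mul, abs_of_pos hβ0]
    rw [integral_const_mul, setIntegral_preimage_affine
      (hΩ.measurableSet.inter measurableSet_closedBall) (fun x => |u t x|) a hr0]
    have hrN : 0 < √H ^ N := by positivity
    calc _ < H ^ (1 / (p - 1)) * ((√H ^ N)⁻¹ * (ε * (H ^ (-(1 / (p - 1))) * √H ^ N))) := by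
          gcongr
      _ = ε := by rw [Real.rpow_neg hH0.le]; field_simp

theorem IsClassicalSolution.integrableOn (hu : IsClassicalSolution p Ω u₀ T u) (hΩ : IsOpen Ω)
    (hu₀ : MemLp u₀ ⊤ (volume.restrict Ω)) (hI : TypeIEstimate p Ω T M u) (hM : 0 < M) {t : ℝ}
    (ht : t ∈ Ico 0 T) (ρ : ℝ) : IntegrableOn (u t) (Ω ∩ Metric.closedBall a ρ) := by
  have hsub : volume.restrict (Ω ∩ Metric.closedBall a ρ) ≤ volume.restrict Ω :=
    Measure.restrict_mono inter_subset_left le_rfl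
  have : IsFiniteMeasure (volume.restrict (Ω ∩ Metric.closedBall a ρ)) :=
    isFiniteMeasure_restrict.2 (measure_inter_lt_top_of_right_ne_top
      measure_closedBall_lt_top.ne).ne
  exact Integrable.of_bound ((hu.aestronglyMeasurable hΩ hu₀ ht).mono_measure hsub) _
    (ae_mono hsub (hI.ae_le hM ht))

/-- Lower bounds on the mass pass to the initial time. -/
theorem IsClassicalSolution.mass_lower_bound_initial (hu : IsClassicalSolution p Ω u₀ T u)
    (hΩ : IsOpen Ω) (hu₀ : MemLp u₀ ⊤ (volume.restrict Ω)) (hI : TypeIEstimate p Ω T M u)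
    (hM : 0 < M) (hT : 0 < T) {ε k : ℝ} (hk : 0 < k)
    (hmass : ∀ t ∈ Ioo 0 T, ε * ((T - t) ^ (-(1 / (p - 1))) * √(T - t) ^ N) ≤
      ∫ x in Ω ∩ Metric.closedBall a (k * √(T - t)), |u t x|) :
    ε * ((T - 0) ^ (-(1 / (p - 1))) * √(T - 0) ^ N) ≤
      ∫ x in Ω ∩ Metric.closedBall a (k * √(T - 0)), |u 0 x| := by
  set S := Ω ∩ Metric.closedBall a (k * √(T - 0)) with hS
  have hSm : MeasurableSet S := hΩ.measurableSet.inter measurableSet_closedBall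
  obtain ⟨R, hR0, hR⟩ : ∃ R > 0, Metric.closedBall a (k * √(T - 0)) ⊆ Metric.ball 0 R := by
    obtain ⟨R, hR⟩ := (Metric.isBounded_closedBall (x := a) (r := k * √(T - 0))).subset_ball 0
    exact ⟨max R 1, by positivity, hR.trans (Metric.ball_subset_ball (le_max_left _ _))⟩
  have hint : ∀ {t}, t ∈ Ico 0 T → IntegrableOn (u t) S := fun ht =>
    hu.integrableOn hΩ hu₀ hI hM ht _
  have h0 : (0 : ℝ) ∈ Ico 0 T := ⟨le_rfl, hT⟩
  have hlim := hu.initial_limit R hR0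
  have hlim' := (ENNReal.tendsto_toReal ENNReal.zero_ne_top).comp hlim
  have hL : Tendsto (fun t : ℝ => ε * ((T - t) ^ (-(1 / (p - 1))) * √(T - t) ^ N)) (𝓝[>] 0)
      (𝓝 (ε * ((T - 0) ^ (-(1 / (p - 1))) * √(T - 0) ^ N))) := by
    refine Tendsto.mono_left ?_ nhdsWithin_le_nhds
    refine ContinuousAt.tendsto (f := fun t : ℝ => ε * ((T - t) ^ (-(1 / (p - 1))) * √(T - t) ^ N))
      (continuousAt_const.mul (ContinuousAt.mul ?_ (by fun_prop)))
    exact ContinuousAt.rpow_const (by fun_prop) (Or.inl (by simpa using hT.ne'))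
  have hRt : Tendsto (fun t => (∫ x in S, |u 0 x|) +
      (∫⁻ x in Ω ∩ Metric.ball 0 R, ‖u t x - u₀ x‖ₑ).toReal) (𝓝[>] 0)
      (𝓝 ((∫ x in S, |u 0 x|) + (0 : ℝ≥0∞).toReal)) := tendsto_const_nhds.add hlim'
  rw [ENNReal.toReal_zero, add_zero] at hRt
  refine le_of_tendsto_of_tendsto hL hRt ?_
  filter_upwards [Ioo_mem_nhdsGT hT, hlim.eventually (gt_mem_nhds ENNReal.zero_lt_top)]
    with t ht hfin
  have htI : t ∈ Ico 0 T := ⟨ht.1.le, ht.2⟩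
  refine (hmass t ht).trans ?_
  have hdiff : ∫ x in S, |u t x - u 0 x| ≤
      (∫⁻ x in Ω ∩ Metric.ball 0 R, ‖u t x - u₀ x‖ₑ).toReal := by
    have h1 : ∫ x in S, |u t x - u 0 x| = (∫⁻ x in S, ‖u t x - u 0 x‖ₑ).toReal :=
      integral_norm_eq_lintegral_enorm ((hint htI).sub (hint h0)).aestronglyMeasurable
    rw [h1]
    refine ENNReal.toReal_mono hfin.ne ?_
    have h2 : ∫⁻ x in S, ‖u t x - u 0 x‖ₑ = ∫⁻ x in S, ‖u t x - u₀ x‖ₑ := by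
      refine lintegral_congr_ae ?_
      filter_upwards [ae_mono (Measure.restrict_mono inter_subset_left le_rfl) hu.initial] with x hx
      rw [hx]
    rw [h2]
    exact lintegral_mono_set (inter_subset_inter_right _ hR)
  calc ∫ x in Ω ∩ Metric.closedBall a (k * √(T - t)), |u t x| ≤ ∫ x in S, |u t x| := by
        refine setIntegral_mono_set (hint htI).abs (Eventually.of_forall fun x => abs_nonneg _) ?_
        refine LE.le.eventuallyLE (inter_subset_inter_right _
          (Metric.closedBall_subset_closedBall ?_))
        gcongr
        linarith [ht.1]
    _ ≤ ∫ x in S, (|u 0 x| + |u t x - u 0 x|) := by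
        refine integral_mono (hint htI).abs ((hint h0).abs.add ((hint htI).sub (hint h0)).abs)
          fun x => ?_
        have := abs_add_le (u 0 x) (u t x - u 0 x)
        simpa using this
    _ = (∫ x in S, |u 0 x|) + ∫ x in S, |u t x - u 0 x| :=
        integral_add (hint h0).abs ((hint htI).sub (hint h0)).abs
    _ ≤ _ := by gcongr

end Solution

/-- On a set of controlled measure, a lower bound on the `L¹` norm of a bounded function gives a
scale invariant lower bound on its `L^q` norm. -/
theorem exists_le_integral_rpow {ε M V q : ℝ} (hε : 0 < ε) (hM : 0 < M) (hV : 0 < V) (hq : 0 < q) :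
    ∃ η > (0 : ℝ), ∀ {α : Type} [MeasurableSpace α] (μ : Measure α) [IsFiniteMeasure μ]
      (f : α → ℝ) (Λ : ℝ), 0 < Λ → AEStronglyMeasurable f μ → (∀ᵐ x ∂μ, |f x| ≤ M * Λ) →
      μ.real univ ≤ V * Λ ^ (-q) → ε * (Λ * Λ ^ (-q)) ≤ ∫ x, |f x| ∂μ →
      η ≤ ∫ x, |f x| ^ q ∂μ := by
  have hintf : ∀ {α : Type} [MeasurableSpace α] (μ : Measure α) [IsFiniteMeasure μ]
      (f : α → ℝ) (B : ℝ), AEStronglyMeasurable f μ → (∀ᵐ x ∂μ, |f x| ≤ B) →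
      Integrable (fun x => |f x|) μ ∧ Integrable (fun x => |f x| ^ q) μ := by
    intro α _ μ _ f B hf hB
    refine ⟨(Integrable.of_bound hf B hB).abs, Integrable.of_bound (C := B ^ q) ?_ ?_⟩
    · exact (Real.continuous_rpow_const hq.le).comp_aestronglyMeasurable hf.norm
    · filter_upwards [hB] with x hx
      rw [Real.norm_eq_abs, abs_of_nonneg (by positivity)]
      gcongr
  rcases le_or_gt q 1 with hq1 | hq1
  · refine ⟨ε / M ^ (1 - q), by positivity, fun μ _ f Λ hΛ hf hB hμ hmass => ?_⟩
    obtain ⟨hi1, hiq⟩ := hintf μ f _ hf hB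
    have hle : ∫ x, |f x| ∂μ ≤ ∫ x, (M * Λ) ^ (1 - q) * |f x| ^ q ∂μ := by
      refine integral_mono_ae hi1 (hiq.const_mul _) ?_
      filter_upwards [hB] with x hx
      rcases (abs_nonneg (f x)).eq_or_lt with h0 | h0
      · rw [← h0]; positivity
      · calc |f x| = |f x| ^ (1 - q) * |f x| ^ q := by
              rw [← Real.rpow_add h0]; simp
          _ ≤ _ := by gcongr
    rw [integral_const_mul, Real.mul_rpow hM.le hΛ.le] at hle
    have hΛq : Λ * Λ ^ (-q) = Λ ^ (1 - q) := by
      rw [sub_eq_add_neg, Real.rpow_add hΛ, Real.rpow_one]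
    rw [hΛq] at hmass
    have h1 : 0 < Λ ^ (1 - q) := by positivity
    rw [div_le_iff₀ (by positivity)]
    refine le_of_mul_le_mul_right ?_ h1
    linarith [hmass.trans hle]
  · refine ⟨ε / 2 / (ε / (2 * V)) ^ (1 - q), by positivity,
      fun μ _ f Λ hΛ hf hB hμ hmass => ?_⟩
    obtain ⟨hi1, hiq⟩ := hintf μ f _ hf hB
    set lam := ε / (2 * V) * Λ with hlam
    have hlam0 : 0 < lam := by positivity
    have hle : ∫ x, |f x| ∂μ ≤ ∫ x, (lam + lam ^ (1 - q) * |f x| ^ q) ∂μ := by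
      refine integral_mono hi1 ((integrable_const _).add (hiq.const_mul _)) fun x => ?_
      rcases le_or_gt |f x| lam with h0 | h0
      · have : 0 ≤ lam ^ (1 - q) * |f x| ^ q := by positivity
        simp only
        linarith
      · have hpos := hlam0.trans h0
        have h2 : |f x| ^ (1 - q) ≤ lam ^ (1 - q) :=
          Real.rpow_le_rpow_of_nonpos hlam0 h0.le (by linarith)
        calc |f x| = |f x| ^ (1 - q) * |f x| ^ q := by
              rw [← Real.rpow_add hpos]; simp
          _ ≤ lam ^ (1 - q) * |f x| ^ q := by gcongr
          _ ≤ _ := by linarith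
    rw [integral_add (integrable_const _) (hiq.const_mul _), integral_const, integral_const_mul,
      smul_eq_mul] at hle
    have h3 : μ.real univ * lam ≤ ε / 2 * (Λ * Λ ^ (-q)) := by
      calc _ ≤ V * Λ ^ (-q) * lam := by gcongr
        _ = _ := by rw [hlam]; field_simp
    have hΛq : Λ * Λ ^ (-q) = Λ ^ (1 - q) := by
      rw [sub_eq_add_neg, Real.rpow_add hΛ, Real.rpow_one]
    rw [hlam, Real.mul_rpow (by positivity) hΛ.le] at hle
    rw [hΛq] at hmass
    rw [hΛq, hlam] at h3
    have h1 : 0 < Λ ^ (1 - q) := by positivity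
    rw [div_le_iff₀ (by positivity)]
    refine le_of_mul_le_mul_right ?_ h1
    linarith [hmass.trans hle]

end SemilinearHeat

theorem lemma3p1 (N : ℕ) (hN : 1 ≤ N) (p : ℝ) (hp : 1 < p) (M : ℝ) (hM : 0 < M) :
    ∃ η₁ > (0 : ℝ), ∃ k₁ > (0 : ℝ),
      ∀ (Ω : Set (EuclideanSpace ℝ (Fin N))) (u₀ : EuclideanSpace ℝ (Fin N) → ℝ) (T : ℝ)
        (u : ℝ → EuclideanSpace ℝ (Fin N) → ℝ),
        SemilinearHeat.IsSmoothDomain Ω →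
        MemLp u₀ ⊤ (volume.restrict Ω) →
        SemilinearHeat.IsBlowUpSolution p Ω u₀ T u →
        SemilinearHeat.TypeIEstimate p Ω T M u →
        ∀ a, SemilinearHeat.IsBlowUpPoint Ω T u a →
          ∀ t ∈ Set.Ico 0 T,
            η₁ ≤ ∫ x in Ω ∩ {x | ‖x - a‖ ≤ k₁ * √(T - t)},
              |u t x| ^ ((N : ℝ) * (p - 1) / 2) := by
  obtain ⟨ε, hε, k, hk, hmass⟩ := SemilinearHeat.exists_mass_lower_bound N hp hM
  have hp1 : 0 < p - 1 := by linarith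
  have hN0 : (0 : ℝ) < N := by exact_mod_cast hN
  set W : ℝ := volume.real (Metric.ball (0 : EuclideanSpace ℝ (Fin N)) 1)
  have hW : 0 < W :=
    ENNReal.toReal_pos (Metric.measure_ball_pos _ _ one_pos).ne' measure_ball_lt_top.ne
  have hq : 0 < (N : ℝ) * (p - 1) / 2 := by positivity
  obtain ⟨η, hη, hmain⟩ := SemilinearHeat.exists_le_integral_rpow hε hM
    (by positivity : 0 < k ^ N * W) hq
  refine ⟨η, hη, k, hk, fun Ω u₀ T u hΩ hu₀ hu hI a ha t ht => ?_⟩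
  have hcl := hu.isClassicalSolution
  have hopen := hΩ.isOpen
  have hpos := hmass Ω u₀ T u hopen hcl hI a ha
  have hτ : 0 < T - t := sub_pos.2 ht.2
  have hlow : ε * ((T - t) ^ (-(1 / (p - 1))) * √(T - t) ^ N) ≤
      ∫ x in Ω ∩ Metric.closedBall a (k * √(T - t)), |u t x| := by
    rcases ht.1.eq_or_lt with rfl | h0
    · exact hcl.mass_lower_bound_initial hopen hu₀ hI hM hu.time_pos hk hpos
    · exact hpos t ⟨h0, ht.2⟩
  have hscale : ((T - t) ^ (-(1 / (p - 1)))) ^ (-((N : ℝ) * (p - 1) / 2)) = √(T - t) ^ N := by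
    rw [← Real.rpow_mul hτ.le, Real.sqrt_eq_rpow, ← Real.rpow_natCast, ← Real.rpow_mul hτ.le]
    congr 1
    field_simp
  have hset : {x | ‖x - a‖ ≤ k * √(T - t)} = Metric.closedBall a (k * √(T - t)) := by
    ext x
    rw [Metric.mem_closedBall, dist_eq_norm]
    rfl
  rw [hset]
  set S := Ω ∩ Metric.closedBall a (k * √(T - t)) with hS
  have hsub : volume.restrict S ≤ volume.restrict Ω :=
    Measure.restrict_mono inter_subset_left le_rfl
  have hfin : IsFiniteMeasure (volume.restrict S) :=
    isFiniteMeasure_restrict.2 (measure_inter_lt_top_of_right_ne_top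
      measure_closedBall_lt_top.ne).ne
  refine hmain (volume.restrict S) (u t) ((T - t) ^ (-(1 / (p - 1)))) (by positivity)
    ((hcl.aestronglyMeasurable hopen hu₀ ht).mono_measure hsub)
    (ae_mono hsub (hI.ae_le hM ht)) ?_ ?_
  · rw [hscale, measureReal_restrict_apply_univ]
    calc volume.real S ≤ volume.real (Metric.closedBall a (k * √(T - t))) :=
          measureReal_mono inter_subset_right measure_closedBall_lt_top.ne
      _ = (k * √(T - t)) ^ N * W := by
          simp only [Measure.real, W]
          rw [Measure.addHaar_closedBall _ a (by positivity), ENNReal.toReal_mul,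
            ENNReal.toReal_ofReal (by positivity), finrank_euclideanSpace_fin]
      _ = k ^ N * W * √(T - t) ^ N := by ring
  · rw [hscale]
    exact hlow
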